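/- Let $n\ge 0$, let $\mathbf k=(k_0,\dots,k_n)$ and $\mathbf r=(r_1,\dots,r_n)$ be sequences of positive integers, and put $r_0=r_{n+1}=1$. The tensor train variety $V_{\mathbf k,\mathbf r}\subseteq\mathbb P\big(\bigotimes_{i=0}^n\mathbb C^{k_i}\big)$ is the Zariski closure of the set of all points $[\psi]$ with $$\psi_{j_0,\dots,j_n}=A_0^{(j_0)}A_1^{(j_1)}\cdots A_n^{(j_n)}\qquad(1\le j_i\le k_i),\qquad \psi\neq 0,$$ where the $A_i^{(j)}$ $(0\le i\le n,\ 1\le j\le k_i)$ are complex $r_i\times r_{i+1}$ matrices. Suppose that the set $\{i: r_i>1\}$ is the union of $\ell\ge 0$ blocks of consecutive indices $I_p=\{a_p,a_p+1,\dots,b_p\}$, $a_p\le b_p$ $(p=1,\dots,\ell)$, which are separated: any two different blocks are disjoint and contain no two adjacent indices. Suppose moreover that every block $I_p$ splits into an initial part and a final part (either may be empty) such that $$r_i\ \ge\ r_{i-1}k_{i-1}\ \text{ for every $i$ in the initial part},\qquad r_i\ \ge\ r_{i+1}k_i\ \text{ for every $i$ in the final part.}$$ (If all $k_v\ge 2$,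 this says that every $i\in\bigcup_p I_p$ satisfies at least one of these two inequalities.) Let $K_p=\prod_{v=a_p-1}^{b_p}k_v$ and let $j_1,\dots,j_s$ be the indices $j\in\{0,\dots,n\}$ with $r_j=r_{j+1}=1$. Then $$V_{\mathbf k,\mathbf r}\ \cong\ \mathbb P^{K_1-1}\times\cdots\times\mathbb P^{K_\ell-1}\times\mathbb P^{k_{j_1}-1}\times\cdots\times\mathbb P^{k_{j_s}-1}$$ as algebraic varieties; more precisely, after a suitable relabelling of the homogeneous coordinates of $\mathbb P\big(\bigotimes_i\mathbb C^{k_i}\big)$, the Segre map is an isomorphism from the product onto $V_{\mathbf k,\mathbf r}$. Moreover $$\dim V_{\mathbf k,\mathbf r}=\sum_{p=1}^{\ell}(K_p-1)+\sum_{q=1}^{s}(k_{j_q}-1),\qquad \deg V_{\mathbf k,\mathbf r}=\frac{\Big(\sum_{p=1}^{\ell}(K_p-1)+\sum_{q=1}^{s}(k_{j_q}-1)\Big)!}{\prod_{p=1}^{\ell}(K_p-1)!\ \prod_{q=1}^{s}(k_{j_q}-1)!}.$$ -/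

import Mathlib

open scoped LinearAlgebra.Projectivization Nat

noncomputable section

/-! ### Complex projective varieties -/

/-- The complex projective space with homogeneous coordinates indexed by `σ`; so
`PSpace (Fin d)` is the projective space of dimension `d - 1`. -/
abbrev PSpace (σ : Type) : Type := ℙ ℂ (σ → ℂ)

/-- `F` is a homogeneous polynomial (of some degree). -/
def IsForm {σ : Type} (F : MvPolynomial σ ℂ) : Prop := ∃ d : ℕ, F.IsHomogeneous d

/-- Vanishing of a polynomial at the chosen representative of a projective point; for a form
this does not depend on the representative. -/
def VanishesAt {σ : Type} (F : MvPolynomial σ ℂ) (x : PSpace σ) : Prop :=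
  MvPolynomial.eval x.rep F = 0

/-- The common zeros of a set of forms. -/
def projZeroLocus {σ : Type} (S : Set (MvPolynomial σ ℂ)) : Set (PSpace σ) :=
  {x | ∀ F ∈ S, VanishesAt F x}

/-- The Zariski topology: the closed sets are the zero loci of sets of forms. -/
instance zariskiTopology (σ : Type) : TopologicalSpace (PSpace σ) :=
  TopologicalSpace.ofClosed {Z | ∃ S : Set (MvPolynomial σ ℂ),
      (∀ F ∈ S, IsForm F) ∧ Z = projZeroLocus S}
    (by
      refine ⟨{1}, ?_, ?_⟩
      · rintro F rfl
        exact ⟨0, MvPolynomial.isHomogeneous_one σ ℂ⟩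
      · ext x
        simp [projZeroLocus, VanishesAt])
    (by
      intro A hA
      refine ⟨{F | IsForm F ∧ ∃ Z ∈ A, ∀ x ∈ Z, VanishesAt F x}, fun F hF => hF.1, ?_⟩
      ext x
      constructor
      · rintro hx F ⟨-, Z, hZ, hF⟩
        exact hF x (hx Z hZ)
      · intro hx Z hZ
        obtain ⟨S, hS, rfl⟩ := hA hZ
        exact fun F hF => hx F ⟨hS F hF, _, hZ, fun y hy => hy F hF⟩)
    (by
      rintro _ ⟨S, hS, rfl⟩ _ ⟨T, hT, rfl⟩
      refine ⟨{H | ∃ F ∈ S, ∃ G ∈ T, H = F * G}, ?_, ?_⟩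
      · rintro _ ⟨F, hF, G, hG, rfl⟩
        obtain ⟨d, hd⟩ := hS F hF
        obtain ⟨e, he⟩ := hT G hG
        exact ⟨d + e, hd.mul he⟩
      · ext x
        constructor
        · rintro (hx | hx) _ ⟨F, hF, G, hG, rfl⟩
          · have h0 : MvPolynomial.eval x.rep F = 0 := hx F hF
            simp [VanishesAt, h0]
          · have h0 : MvPolynomial.eval x.rep G = 0 := hx G hG
            simp [VanishesAt, h0]
        · intro hx
          by_contra hcon
          simp only [Set.mem_union, not_or, projZeroLocus, Set.mem_ofPred_eq, not_forall] at hcon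
          obtain ⟨⟨F, hF, hFx⟩, ⟨G, hG, hGx⟩⟩ := hcon
          have h0 : MvPolynomial.eval x.rep (F * G) = 0 := hx _ ⟨F, hF, G, hG, rfl⟩
          rw [map_mul] at h0
          exact (mul_eq_zero.mp h0).elim hFx hGx)

/-- The forms of degree `m` vanishing on `V`, i.e. the degree `m` part of the homogeneous
ideal of `V`, as a subspace of the space of all forms of degree `m`. -/
def vanishingForms {σ : Type} (V : Set (PSpace σ)) (m : ℕ) :
    Submodule ℂ (MvPolynomial.homogeneousSubmodule σ ℂ m) where
  carrier := {F | ∀ x ∈ V, VanishesAt (F : MvPolynomial σ ℂ) x}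
  zero_mem' := by
    intro x _
    simp [VanishesAt]
  add_mem' := by
    intro F G hF hG x hx
    have h1 : MvPolynomial.eval x.rep (F : MvPolynomial σ ℂ) = 0 := hF x hx
    have h2 : MvPolynomial.eval x.rep (G : MvPolynomial σ ℂ) = 0 := hG x hx
    simp [VanishesAt, h1, h2]
  smul_mem' := by
    intro c F hF x hx
    have h1 : MvPolynomial.eval x.rep (F : MvPolynomial σ ℂ) = 0 := hF x hx
    simp [VanishesAt, MvPolynomial.smul_eval, h1]

/-- The Hilbert function of `V`: the dimension of the degree `m` part of its homogeneous
coordinate ring. -/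
def hilbertFunction {σ : Type} (V : Set (PSpace σ)) (m : ℕ) : ℕ :=
  Module.finrank ℂ (MvPolynomial.homogeneousSubmodule σ ℂ m ⧸ vanishingForms V m)

/-- `V` has degree `δ`: it has a Hilbert polynomial `P`, whose degree is the (Krull) dimension
of `V`, and `δ` is `(dim V)!` times the leading coefficient of `P`. -/
def HasDegree {σ : Type} (V : Set (PSpace σ)) (δ : ℚ) : Prop :=
  ∃ P : Polynomial ℚ,
    (∀ᶠ m : ℕ in Filter.atTop, (hilbertFunction V m : ℚ) = P.eval (m : ℚ)) ∧
    topologicalKrullDim V = (P.natDegree : WithBot ℕ∞) ∧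
    (P.natDegree ! : ℚ) * P.leadingCoeff = δ

/-! ### Regular maps and products of projective spaces -/

/-- A map from a subset `X` of a projective space to a projective space is regular if near
every point of `X` it is given by forms of one and the same degree. The neighbourhood may be
taken to be the set of points of `X` where these forms do not vanish simultaneously. -/
def IsRegularOn {σ τ : Type} (X : Set (PSpace σ)) (f : X → PSpace τ) : Prop :=
  ∀ x : X, ∃ (d : ℕ) (F : τ → MvPolynomial σ ℂ), (∀ t, (F t).IsHomogeneous d) ∧
    (fun t => MvPolynomial.eval x.1.rep (F t)) ≠ 0 ∧
    ∀ (y : X) (hy : (fun t => MvPolynomial.eval y.1.rep (F t)) ≠ 0),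
      f y = Projectivization.mk ℂ _ hy

/-- A polynomial in the coordinates of `∏ i, PSpace (σ i)` that is homogeneous of degree `D i`
in the `i`-th group of variables, for every `i`. -/
def IsMultihomogeneous {κ : Type} [DecidableEq κ] {σ : κ → Type}
    (F : MvPolynomial (Σ i, σ i) ℂ) (D : κ → ℕ) : Prop :=
  MvPolynomial.IsWeightedHomogeneous
    (fun s : Σ i, σ i => (Pi.single s.1 1 : κ → ℕ)) F D

/-- The value of a polynomial in all the coordinates at the chosen representatives of the
components of a point of a product of projective spaces. -/
def multiEval {κ : Type} {σ : κ → Type} (y : ∀ i, PSpace (σ i))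
    (F : MvPolynomial (Σ i, σ i) ℂ) : ℂ :=
  MvPolynomial.eval (fun s : Σ i, σ i => (y s.1).rep s.2) F

/-- A map from a product of projective spaces to a projective space is regular if near every
point it is given by multihomogeneous polynomials of one and the same multidegree. -/
def IsMultiRegular {κ : Type} [DecidableEq κ] {σ : κ → Type} {τ : Type}
    (f : (∀ i, PSpace (σ i)) → PSpace τ) : Prop :=
  ∀ x : ∀ i, PSpace (σ i), ∃ (D : κ → ℕ) (F : τ → MvPolynomial (Σ i, σ i) ℂ),
    (∀ t, IsMultihomogeneous (F t) D) ∧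
    (fun t => multiEval x (F t)) ≠ 0 ∧
    ∀ (y : ∀ i, PSpace (σ i)) (hy : (fun t => multiEval y (F t)) ≠ 0),
      f y = Projectivization.mk ℂ _ hy

/-- An isomorphism of varieties between `V` and a product of projective spaces: a bijection
which is regular in both directions (a map into a product is regular when all of its components
are). -/
def IsBiregular {κ : Type} [DecidableEq κ] {σ : κ → Type} {τ : Type} {V : Set (PSpace τ)}
    (e : V ≃ ∀ i, PSpace (σ i)) : Prop :=
  (∀ i, IsRegularOn V (fun x => e x i)) ∧
    IsMultiRegular (fun y => (e.symm y : PSpace τ))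

/-- Up to the relabelling `ι` of the homogeneous coordinates, `f` is the Segre map
`([u_i])_i ↦ [⨂ u_i]`. -/
def IsSegreMap {κ : Type} [Fintype κ] {σ : κ → Type} {τ : Type} (ι : τ ≃ ∀ i, σ i)
    (f : (∀ i, PSpace (σ i)) → PSpace τ) : Prop :=
  ∀ (u : ∀ i, σ i → ℂ) (hu : ∀ i, u i ≠ 0),
    ∃ h : (fun j : τ => ∏ i, u i (ι j i)) ≠ 0,
      f (fun i => Projectivization.mk ℂ (u i) (hu i)) = Projectivization.mk ℂ _ h

/-! ### Tensor trains -/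

/-- Multi-indices `(j_0, …, j_n)` of a tensor with physical dimensions `k`. -/
abbrev TIndex {n : ℕ} (k : Fin (n + 1) → ℕ) : Type := ∀ v, Fin (k v)

/-- A system of cores: for every vertex `v` and every `j < k v` a matrix of size
`r_v × r_{v+1}`. -/
abbrev TTCores {n : ℕ} (k : Fin (n + 1) → ℕ) (r : Fin (n + 2) → ℕ) : Type :=
  ∀ v : Fin (n + 1), Fin (k v) → Matrix (Fin (r v.castSucc)) (Fin (r v.succ)) ℂ

/-- The matrix product `M_0 M_1 ⋯ M_n`. -/
def chainProd {n : ℕ} {r : Fin (n + 2) → ℕ}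
    (M : ∀ v : Fin (n + 1), Matrix (Fin (r v.castSucc)) (Fin (r v.succ)) ℂ) :
    Matrix (Fin (r 0)) (Fin (r (Fin.last (n + 1)))) ℂ :=
  Fin.induction (motive := fun i => Matrix (Fin (r 0)) (Fin (r i)) ℂ) 1
    (fun v P => P * M v) (Fin.last (n + 1))

/-- The tensor `ψ_{j_0,…,j_n} = A_0^{(j_0)} ⋯ A_n^{(j_n)}`. As `r 0 = r (n + 1) = 1`, the product
is a `1 × 1` matrix, and the sum picks its only entry. -/
def ttTensor {n : ℕ} {k : Fin (n + 1) → ℕ} {r : Fin (n + 2) → ℕ} (A : TTCores k r) :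
    TIndex k → ℂ :=
  fun j => ∑ a, ∑ b, chainProd (fun v => A v (j v)) a b

/-- The tensor train variety: the Zariski closure, in the projective space of tensors, of the
set of all points `[ψ]` parametrized by cores. -/
def ttVariety {n : ℕ} (k : Fin (n + 1) → ℕ) (r : Fin (n + 2) → ℕ) : Set (PSpace (TIndex k)) :=
  closure {x | ∃ (A : TTCores k r) (h : ttTensor A ≠ 0), x = Projectivization.mk ℂ (ttTensor A) h}

/-- The intervals `[a p, b p]` are the separated blocks of `r`: they cover exactly the indices
with `r i > 1`, and no two of them overlap or are adjacent. -/
structure IsBlockDecomposition {n l : ℕ} (r : Fin (n + 2) → ℕ) (a b : Fin l → Fin (n + 2)) :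
    Prop where
  le : ∀ p, a p ≤ b p
  one_lt_iff : ∀ i, 1 < r i ↔ ∃ p, a p ≤ i ∧ i ≤ b p
  separated : ∀ p q, p ≠ q → (b p : ℕ) + 1 < a q ∨ (b q : ℕ) + 1 < a p

/-- The product of the `k v` over the vertices `α - 1 ≤ v ≤ β` that the block of edges
`α, …, β` spans (edge `i` joins the vertices `i - 1` and `i`). -/
def blockSize {n : ℕ} (k : Fin (n + 1) → ℕ) (α β : Fin (n + 2)) : ℕ :=
  ∏ v ∈ Finset.univ.filter
    (fun v : Fin (n + 1) => (α : ℕ) ≤ (v : ℕ) + 1 ∧ (v : ℕ) ≤ (β : ℕ)), k v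

/-- The vertices `v` not touched by a block: both `r_v` and `r_{v+1}` are `1`. -/
abbrev FreeVertex {n : ℕ} (r : Fin (n + 2) → ℕ) : Type :=
  {v : Fin (n + 1) // r v.castSucc = 1 ∧ r v.succ = 1}

/-- The block of bonds `α, …, β` splits into a (possibly empty) initial part `i ≤ c`, on which
`r_i ≥ r_{i-1} k_{i-1}`, and a (possibly empty) final part `i > c`, on which
`r_i ≥ r_{i+1} k_i`. The first inequality is stated at the vertex `v = i - 1` and the second one
at `v = i`. -/
def RankSaturated {n : ℕ} (k : Fin (n + 1) → ℕ) (r : Fin (n + 2) → ℕ) (α β : Fin (n + 2)) :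
    Prop :=
  ∃ c : ℕ, ∀ v : Fin (n + 1),
    ((α : ℕ) ≤ (v : ℕ) + 1 → (v : ℕ) + 1 ≤ (β : ℕ) → (v : ℕ) + 1 ≤ c →
      r v.castSucc * k v ≤ r v.succ) ∧
    ((α : ℕ) ≤ (v : ℕ) → (v : ℕ) ≤ (β : ℕ) → c < (v : ℕ) →
      r v.succ * k v ≤ r v.castSucc)

/-- The numbers of homogeneous coordinates of the factors: one factor for every block, with
`blockSize` coordinates, and one for every free vertex `v`, with `k v` coordinates. -/
def factorSize {n l : ℕ} (k : Fin (n + 1) → ℕ) (r : Fin (n + 2) → ℕ)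
    (a b : Fin l → Fin (n + 2)) : Fin l ⊕ FreeVertex r → ℕ :=
  Sum.elim (fun p => blockSize k (a p) (b p)) (fun v => k v.1)

end

/-!
The bonds of dimension one cut the chain of vertices into parts: one part for every block of bonds
of dimension greater than one, and one part for every remaining vertex. A tensor train is the
tensor product of its restrictions to these parts (`ttTensor_eq_prod_maskedCores`). Conversely,
inside a block the rank inequalities leave enough room to produce an arbitrary tensor: in the
initial part the cores copy all indices read so far into the bond, in the final part they do the
same from the other end, and the core at the vertex in between, the pivot, looks up the entry
(`exists_ttTensor_maskedCores_eq`). So the set of tensor trains is the image of a Segre map, which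
is closed, being cut out by quadrics (`segreVariety_eq_projZeroLocus`); the closure in the
definition of the tensor train variety adds nothing. The Segre map is inverted by the slices of a
tensor, whose entries are linear forms (`isBiregular_segreEquiv`).

The degree `m` part of the coordinate ring of the Segre variety has the monomials of multidegree
`(m, …, m)` as a basis, so the Hilbert function is a product of binomial coefficients
(`hilbertFunction_segreVariety`), which gives the degree. It also bounds the dimension from above:
if `Z ⊂ Z'` are irreducible closed sets, multiplication by a form that vanishes on `Z` but not
on `Z'` shows that the Hilbert function of `Z` grows more slowly than that of `Z'` by one order
(`hilbertFunction_add_le`, `growth_of_increments`), so a chain cannot be longer than the order of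
growth. A chain of products of coordinate subspaces has that length (`segreCell_strictMono`).
-/

/-! ### Forms, closed sets and irreducible sets in projective space -/

theorem MvPolynomial.IsHomogeneous.eval_smul_point {σ : Type} {F : MvPolynomial σ ℂ} {d : ℕ}
    (hF : F.IsHomogeneous d) (c : ℂ) (x : σ → ℂ) :
    MvPolynomial.eval (c • x) F = c ^ d * MvPolynomial.eval x F := by
  rw [MvPolynomial.eval_eq, MvPolynomial.eval_eq, Finset.mul_sum]
  refine Finset.sum_congr rfl fun m hm => ?_
  have hdeg : m.degree = d := by
    have := hF (MvPolynomial.mem_support_iff.mp hm)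
    rw [Finsupp.degree_eq_weight_one]
    exact this
  simp only [Pi.smul_apply, smul_eq_mul, mul_pow, Finset.prod_mul_distrib,
    Finset.prod_pow_eq_pow_sum]
  rw [← hdeg, Finsupp.degree_apply]
  ring

theorem vanishesAt_mk {σ : Type} {F : MvPolynomial σ ℂ} (hF : IsForm F) (v : σ → ℂ)
    (hv : v ≠ 0) : VanishesAt F (Projectivization.mk ℂ v hv) ↔ MvPolynomial.eval v F = 0 := by
  obtain ⟨d, hd⟩ := hF
  obtain ⟨c, hc⟩ := Projectivization.exists_smul_eq_mk_rep ℂ v hv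
  have h : (Projectivization.mk ℂ v hv).rep = (c : ℂ) • v := by
    rw [← hc]
    rfl
  rw [VanishesAt, h, hd.eval_smul_point]
  simp

theorem isClosed_iff_exists_forms {σ : Type} {Z : Set (PSpace σ)} :
    IsClosed Z ↔ ∃ S : Set (MvPolynomial σ ℂ), (∀ F ∈ S, IsForm F) ∧ Z = projZeroLocus S := by
  rw [← isOpen_compl_iff]
  change Zᶜᶜ ∈ {Z | ∃ S : Set (MvPolynomial σ ℂ),
      (∀ F ∈ S, IsForm F) ∧ Z = projZeroLocus S} ↔ _
  rw [compl_compl]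
  rfl

theorem isClosed_projZeroLocus {σ : Type} {S : Set (MvPolynomial σ ℂ)} (hS : ∀ F ∈ S, IsForm F) :
    IsClosed (projZeroLocus S) :=
  isClosed_iff_exists_forms.mpr ⟨S, hS, rfl⟩

/-- A closed set is separated from a point outside it by a form. -/
theorem IsClosed.exists_form_of_notMem {σ : Type} {Z : Set (PSpace σ)} (hZ : IsClosed Z)
    {x : PSpace σ} (hx : x ∉ Z) :
    ∃ (d : ℕ) (F : MvPolynomial σ ℂ), F.IsHomogeneous d ∧ (∀ y ∈ Z, VanishesAt F y) ∧
      ¬ VanishesAt F x := by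
  obtain ⟨S, hS, rfl⟩ := isClosed_iff_exists_forms.mp hZ
  simp only [projZeroLocus, Set.mem_ofPred_eq, not_forall] at hx
  obtain ⟨F, hF, hFx⟩ := hx
  obtain ⟨d, hd⟩ := hS F hF
  exact ⟨d, F, hd, fun y hy => hy F hF, hFx⟩

theorem IsPreirreducible.vanishes_or_vanishes {σ : Type} {Z : Set (PSpace σ)}
    (hZ : IsPreirreducible Z) {F G : MvPolynomial σ ℂ} (hF : IsForm F) (hG : IsForm G)
    (h : ∀ x ∈ Z, VanishesAt (F * G) x) :
    (∀ x ∈ Z, VanishesAt F x) ∨ ∀ x ∈ Z, VanishesAt G x := by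
  have h1 := isPreirreducible_iff_isClosed_union_isClosed.mp hZ (projZeroLocus {F})
    (projZeroLocus {G}) (isClosed_projZeroLocus (by rintro _ rfl; exact hF))
    (isClosed_projZeroLocus (by rintro _ rfl; exact hG)) (by
      intro x hx
      have h0 := h x hx
      rw [VanishesAt, map_mul, mul_eq_zero] at h0
      rcases h0 with h0 | h0
      · exact Or.inl (by rintro _ rfl; exact h0)
      · exact Or.inr (by rintro _ rfl; exact h0))
  exact h1.imp (fun h x hx => h hx F rfl) (fun h x hx => h hx G rfl)

/-- Substitution of polynomials commutes with evaluation. -/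
theorem eval_aeval_eq {σ μ : Type} (Φ : σ → MvPolynomial μ ℂ) (t : μ → ℂ)
    (H : MvPolynomial σ ℂ) :
    MvPolynomial.eval t (MvPolynomial.aeval Φ H) =
      MvPolynomial.eval (fun j => MvPolynomial.eval t (Φ j)) H := by
  rw [← MvPolynomial.coe_aeval_eq_eval, ← MvPolynomial.coe_aeval_eq_eval]
  change (MvPolynomial.aeval t) ((MvPolynomial.aeval Φ) H) = _
  rw [← AlgHom.comp_apply, MvPolynomial.comp_aeval]
  rfl

/-- The image of an affine space under a polynomial parametrization is irreducible. -/
theorem isIrreducible_of_polynomial_parametrization {σ μ : Type}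
    (Φ : σ → MvPolynomial μ ℂ) (t₀ : μ → ℂ) (ht₀ : (fun j => MvPolynomial.eval t₀ (Φ j)) ≠ 0) :
    IsIrreducible {x : PSpace σ | ∃ (t : μ → ℂ) (ht : (fun j => MvPolynomial.eval t (Φ j)) ≠ 0),
      x = Projectivization.mk ℂ _ ht} := by
  refine ⟨⟨_, t₀, ht₀, rfl⟩, ?_⟩
  rw [isPreirreducible_iff_isClosed_union_isClosed]
  intro Z₁ Z₂ h₁ h₂ hsub
  by_contra! hcon
  obtain ⟨hc₁, hc₂⟩ := hcon
  obtain ⟨_, ⟨t₁, ht₁, rfl⟩, hx₁⟩ := Set.not_subset.mp hc₁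
  obtain ⟨_, ⟨t₂, ht₂, rfl⟩, hx₂⟩ := Set.not_subset.mp hc₂
  obtain ⟨d, F, hF, hFZ, hFx⟩ := h₁.exists_form_of_notMem hx₁
  obtain ⟨e, G, hG, hGZ, hGx⟩ := h₂.exists_form_of_notMem hx₂
  rw [vanishesAt_mk ⟨d, hF⟩] at hFx
  rw [vanishesAt_mk ⟨e, hG⟩] at hGx
  obtain ⟨j, hj⟩ := Function.ne_iff.mp ht₀
  have hne : MvPolynomial.aeval Φ F * MvPolynomial.aeval Φ G * Φ j ≠ 0 := by
    refine mul_ne_zero (mul_ne_zero ?_ ?_) ?_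
    · intro h0
      exact hFx (by rw [← eval_aeval_eq, h0, map_zero])
    · intro h0
      exact hGx (by rw [← eval_aeval_eq, h0, map_zero])
    · intro h0
      exact hj (by simp [h0])
  apply hne
  apply MvPolynomial.funext
  intro t
  rw [map_zero, map_mul, map_mul, eval_aeval_eq, eval_aeval_eq]
  by_cases ht : (fun j => MvPolynomial.eval t (Φ j)) = 0
  · rw [show MvPolynomial.eval t (Φ j) = 0 from congrFun ht j, mul_zero]
  · rcases hsub ⟨t, ht, rfl⟩ with hz | hz
    · rw [(vanishesAt_mk ⟨d, hF⟩ _ ht).mp (hFZ _ hz)]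
      simp
    · rw [(vanishesAt_mk ⟨e, hG⟩ _ ht).mp (hGZ _ hz)]
      simp

theorem IsIrreducible.preimage_subtypeVal {X : Type*} [TopologicalSpace X] {V Z : Set X}
    (hZ : IsIrreducible Z) (hZV : Z ⊆ V) : IsIrreducible ((↑) ⁻¹' Z : Set V) := by
  obtain ⟨⟨z, hz⟩, hp⟩ := hZ
  refine ⟨⟨⟨z, hZV hz⟩, hz⟩, ?_⟩
  rintro _ _ ⟨u, hu, rfl⟩ ⟨v, hv, rfl⟩ ⟨x, hx, hxu⟩ ⟨y, hy, hyv⟩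
  obtain ⟨w, hw, hwu⟩ := hp u v hu hv ⟨x, hx, hxu⟩ ⟨y, hy, hyv⟩
  exact ⟨⟨w, hZV hw⟩, hw, hwu⟩

/-! ### Hilbert functions and dimension -/

instance homogeneousSubmodule_finite (σ : Type) [Finite σ] (m : ℕ) :
    Module.Finite ℂ (MvPolynomial.homogeneousSubmodule σ ℂ m) :=
  Module.Finite.iff_fg.mpr (MvPolynomial.homogeneousSubmodule_fg _ _ m)

/-- Multiplication by a form `F` of degree `e` which does not vanish on the irreducible set `Z`
is injective on the coordinate ring of `Z`. It is stated for the map `g` from all forms of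
degree `m` to the coordinate ring, whose range therefore has dimension `hilbertFunction Z m`. -/
theorem exists_mul_form_linearMap {σ : Type} {Z : Set (PSpace σ)}
    (hZ : IsPreirreducible Z) {e : ℕ} {F : MvPolynomial σ ℂ} (hF : F.IsHomogeneous e)
    (hFZ : ¬ ∀ x ∈ Z, VanishesAt F x) (m : ℕ) :
    ∃ g : MvPolynomial.homogeneousSubmodule σ ℂ m →ₗ[ℂ]
        (MvPolynomial.homogeneousSubmodule σ ℂ (m + e) ⧸ vanishingForms Z (m + e)),
      Module.finrank ℂ (LinearMap.range g) = hilbertFunction Z m ∧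
      ∀ G : MvPolynomial.homogeneousSubmodule σ ℂ m,
        ∃ H : MvPolynomial.homogeneousSubmodule σ ℂ (m + e),
          (H : MvPolynomial σ ℂ) = G * F ∧ g G = Submodule.Quotient.mk H := by
  let μ : MvPolynomial.homogeneousSubmodule σ ℂ m →ₗ[ℂ]
      MvPolynomial.homogeneousSubmodule σ ℂ (m + e) :=
    LinearMap.codRestrict _ ((LinearMap.mulRight ℂ F).comp (Submodule.subtype _))
      (fun G => G.2.mul hF)
  have hμ : ∀ G : MvPolynomial.homogeneousSubmodule σ ℂ m,
    (μ G : MvPolynomial σ ℂ) = G * F := fun G => rfl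
  have hker : LinearMap.ker ((Submodule.mkQ (vanishingForms Z (m + e))).comp μ)
      = vanishingForms Z m := by
    ext G
    rw [LinearMap.mem_ker, LinearMap.comp_apply, Submodule.mkQ_apply,
      Submodule.Quotient.mk_eq_zero]
    constructor
    · intro h
      exact (hZ.vanishes_or_vanishes ⟨m, G.2⟩ ⟨e, hF⟩ h).resolve_right hFZ
    · intro h x hx
      have h0 : MvPolynomial.eval x.rep (G : MvPolynomial σ ℂ) = 0 := h x hx
      rw [hμ, VanishesAt, map_mul, h0, zero_mul]
  refine ⟨(Submodule.mkQ _).comp μ, ?_, fun G => ⟨μ G, hμ G, rfl⟩⟩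
  rw [← (LinearMap.quotKerEquivRange _).finrank_eq, hker]
  rfl

theorem hilbertFunction_mono_set {σ : Type} [Finite σ] {Z Z' : Set (PSpace σ)} (h : Z ⊆ Z')
    (m : ℕ) : hilbertFunction Z m ≤ hilbertFunction Z' m := by
  have hle : vanishingForms Z' m ≤ vanishingForms Z m := fun F hF x hx => hF x (h hx)
  exact LinearMap.finrank_le_finrank_of_surjective (f := Submodule.factor hle)
    (Submodule.factor_surjective hle)

/-- The exact sequence `0 → (S / I(Z'))(-e) → S / I(Z') → S / I(Z)`, whose first map is the
multiplication by a form of degree `e` which vanishes on `Z` but not on `Z'`. -/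
theorem hilbertFunction_add_le {σ : Type} [Finite σ] {Z Z' : Set (PSpace σ)} (h : Z ⊆ Z')
    (hZ' : IsPreirreducible Z') {e : ℕ} {F : MvPolynomial σ ℂ} (hF : F.IsHomogeneous e)
    (hFZ : ∀ x ∈ Z, VanishesAt F x) (hFZ' : ¬ ∀ x ∈ Z', VanishesAt F x) (m : ℕ) :
    hilbertFunction Z (m + e) + hilbertFunction Z' m ≤ hilbertFunction Z' (m + e) := by
  obtain ⟨g, hg, hgF⟩ := exists_mul_form_linearMap hZ' hF hFZ' m
  have hle : vanishingForms Z' (m + e) ≤ vanishingForms Z (m + e) := fun F hF x hx => hF x (h hx)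
  have hrange : LinearMap.range g ≤ LinearMap.ker (Submodule.factor hle) := by
    rintro _ ⟨G, rfl⟩
    obtain ⟨H, hH, hgG⟩ := hgF G
    rw [LinearMap.mem_ker, hgG, ← Submodule.mkQ_apply, Submodule.factor_mk,
      Submodule.mkQ_apply, Submodule.Quotient.mk_eq_zero]
    intro x hx
    have h0 : MvPolynomial.eval x.rep F = 0 := hFZ x hx
    rw [hH, VanishesAt, map_mul, h0, mul_zero]
  have hrn := LinearMap.finrank_range_add_finrank_ker (Submodule.factor hle)
  rw [LinearMap.range_eq_top.mpr (Submodule.factor_surjective hle), finrank_top] at hrn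
  have := Submodule.finrank_mono hrange
  rw [hg] at this
  change Module.finrank ℂ _ + _ ≤ Module.finrank ℂ _
  omega

theorem hilbertFunction_monotone {σ : Type} [Finite σ] {Z : Set (PSpace σ)}
    (hZ : IsIrreducible Z) : Monotone (hilbertFunction Z) := by
  refine monotone_nat_of_le_succ fun m => ?_
  obtain ⟨x, hx⟩ := hZ.nonempty
  obtain ⟨j, hj⟩ := Function.ne_iff.mp x.rep_nonzero
  obtain ⟨g, hg, -⟩ := exists_mul_form_linearMap hZ.isPreirreducible
    (MvPolynomial.isHomogeneous_X ℂ j) (fun h => hj (by simpa [VanishesAt] using h x hx)) m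
  rw [← hg]
  exact Submodule.finrank_le _

theorem hilbertFunction_zero_pos {σ : Type} [Finite σ] {Z : Set (PSpace σ)} (hZ : Z.Nonempty) :
    0 < hilbertFunction Z 0 := by
  obtain ⟨x, hx⟩ := hZ
  let one : MvPolynomial.homogeneousSubmodule σ ℂ 0 := ⟨1, MvPolynomial.isHomogeneous_one σ ℂ⟩
  have hne : (Submodule.Quotient.mk one :
      MvPolynomial.homogeneousSubmodule σ ℂ 0 ⧸ vanishingForms Z 0) ≠ 0 := by
    rw [Ne, Submodule.Quotient.mk_eq_zero]
    intro h
    have h0 := h x hx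
    simp [VanishesAt, one] at h0
  exact Module.finrank_pos_iff_exists_ne_zero.mpr ⟨_, hne⟩

/-- If `h (m + e)` is at most the increment of `H` from `m` to `m + e` and `h` is monotone, then
`H` grows faster than `h`, as one sees by summing up `q` increments. For `q` proportional to `m`,
the gain is one order of growth. -/
theorem growth_of_increments {h H : ℕ → ℕ} (hmono : Monotone h) {e : ℕ}
    (hH : ∀ m, h (m + e) + H m ≤ H (m + e)) (q m : ℕ) : q * h m ≤ H (m + q * e) := by
  induction q with
  | zero => simp
  | succ q ih =>
    have h1 := hH (m + q * e)
    have h2 : h m ≤ h (m + q * e + e) := hmono (by omega)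
    rw [show m + (q + 1) * e = m + q * e + e by ring, add_mul, one_mul]
    omega

/-- An irreducible closed set, whose Hilbert function grows at most like `m ^ D`, has height at
most `D` among the irreducible closed sets. -/
theorem height_le_of_hilbertFunction_le {σ : Type} [Finite σ] (D : ℕ) :
    ∀ (Z : TopologicalSpace.IrreducibleCloseds (PSpace σ)) (C : ℕ),
      (∀ m, hilbertFunction (Z : Set (PSpace σ)) m ≤ C * (m + 1) ^ D) →
      Order.height Z ≤ D := by
  induction D with
  | zero =>
    intro Z C hC
    rw [Order.height_le_coe_iff]
    intro Y hY
    exfalso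
    obtain ⟨x, hxZ, hxY⟩ := Set.exists_of_ssubset (SetLike.coe_ssubset_coe.mpr hY)
    obtain ⟨e, F, hF, hFY, hFx⟩ := Y.isClosed.exists_form_of_notMem hxY
    -- A proper irreducible closed subset would make the Hilbert function of `Z` unbounded.
    have h1 := growth_of_increments (hilbertFunction_monotone Y.isIrreducible)
      (hilbertFunction_add_le (SetLike.coe_subset_coe.mpr hY.le) Z.isIrreducible.isPreirreducible
        hF hFY (fun h => hFx (h x hxZ))) (C + 1) 0
    have h2 := hilbertFunction_zero_pos Y.isIrreducible.nonempty
    have h3 := hC (0 + (C + 1) * e)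
    rw [pow_zero, mul_one] at h3
    have h4 := Nat.le_mul_of_pos_right (C + 1) h2
    omega
  | succ D ih =>
    intro Z C hC
    rw [Order.height_le_coe_iff]
    intro Y hY
    obtain ⟨x, hxZ, hxY⟩ := Set.exists_of_ssubset (SetLike.coe_ssubset_coe.mpr hY)
    obtain ⟨e, F, hF, hFY, hFx⟩ := Y.isClosed.exists_form_of_notMem hxY
    have h1 := growth_of_increments (hilbertFunction_monotone Y.isIrreducible)
      (hilbertFunction_add_le (SetLike.coe_subset_coe.mpr hY.le) Z.isIrreducible.isPreirreducible
        hF hFY (fun h => hFx (h x hxZ)))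
    have h2 : Order.height Y ≤ D := by
      refine ih Y (C * (e + 1) ^ (D + 1)) fun m => ?_
      -- With `q = m + 1` increments, the bound for `Z` can be divided by `m + 1`.
      have h3 := (h1 (m + 1) m).trans (hC _)
      rw [show m + (m + 1) * e + 1 = (m + 1) * (e + 1) by ring] at h3
      rw [mul_pow] at h3
      refine le_of_mul_le_mul_left (h3.trans (le_of_eq ?_)) (Nat.succ_pos m)
      ring
    refine lt_of_le_of_lt h2 ?_
    exact_mod_cast Nat.lt_succ_self D

theorem topologicalKrullDim_le_of_hilbertFunction_le {σ : Type} [Finite σ] {V : Set (PSpace σ)}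
    (hV : IsClosed V) {C D : ℕ} (h : ∀ m, hilbertFunction V m ≤ C * (m + 1) ^ D) :
    topologicalKrullDim V ≤ D := by
  rw [topologicalKrullDim, Order.krullDim_eq_iSup_height]
  refine iSup_le fun Z => ?_
  have h1 := Order.height_le_height_apply_of_strictMono _
    (TopologicalSpace.IrreducibleCloseds.map_strictMono_of_isInducing
      (Topology.IsInducing.subtypeVal (t := V))) Z
  have h2 := height_le_of_hilbertFunction_le D
    (TopologicalSpace.IrreducibleCloseds.map _ continuous_subtype_val Z) C (fun m => by
      refine (hilbertFunction_mono_set ?_ m).trans (h m)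
      rw [TopologicalSpace.IrreducibleCloseds.coe_map]
      exact closure_minimal (by rintro _ ⟨x, -, rfl⟩; exact x.2) hV)
  exact_mod_cast h1.trans h2

/-- In a product of finite chains, the height of `c` is at least `∑ i, c i`: lower one coordinate
at a time. -/
theorem sum_le_krullDim_of_strictMono {κ : Type} [Fintype κ] {N : κ → ℕ} {α : Type*} [Preorder α]
    (f : (∀ i, Fin (N i)) → α) (hf : StrictMono f) (c : ∀ i, Fin (N i)) :
    ((∑ i, (c i : ℕ) : ℕ) : WithBot ℕ∞) ≤ Order.krullDim α := by
  classical
  have key : ∀ (D : ℕ) (c : ∀ i, Fin (N i)), ∑ i, (c i : ℕ) = D → (D : ℕ∞) ≤ Order.height c := by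
    intro D
    induction D with
    | zero => simp
    | succ D ih =>
      intro c hc
      obtain ⟨i, hi⟩ : ∃ i, 0 < (c i : ℕ) := by
        by_contra! hcon
        have : ∑ i, (c i : ℕ) = 0 := Finset.sum_eq_zero fun i _ => Nat.le_zero.mp (hcon i)
        omega
      let c' : ∀ i, Fin (N i) := Function.update c i ⟨c i - 1, by omega⟩
      have hlt : c' < c := by
        rw [update_lt_self_iff]
        exact Fin.lt_def.mpr (by simp; omega)
      have hsum : ∑ i, (c' i : ℕ) = D := by
        rw [← Finset.add_sum_erase _ _ (Finset.mem_univ i)] at hc ⊢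
        have : ∑ x ∈ Finset.univ.erase i, (c' x : ℕ) = ∑ x ∈ Finset.univ.erase i, (c x : ℕ) :=
          Finset.sum_congr rfl fun x hx => by
            simp [c', Function.update_of_ne (Finset.ne_of_mem_erase hx)]
        rw [this]
        simp only [c', Function.update_self]
        omega
      have := Order.height_add_one_le hlt
      refine le_trans ?_ this
      have := ih c' hsum
      push_cast
      gcongr
  refine le_trans ?_ (Order.krullDim_le_of_strictMono f hf)
  refine le_trans ?_ (Order.height_le_krullDim c)
  exact_mod_cast key _ c rfl

/-! ### The Segre embedding -/

/-- The decomposable tensor `⨂ u_i`, with coordinates relabelled by `ι`. -/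
noncomputable def segreTensor {κ : Type} [Fintype κ] {σ : κ → Type} {τ : Type} (ι : τ ≃ ∀ i, σ i)
    (u : ∀ i, σ i → ℂ) : τ → ℂ :=
  fun j => ∏ i, u i (ι j i)

section Segre

variable {κ : Type} {σ : κ → Type} {τ : Type} (ι : τ ≃ ∀ i, σ i)

/-- The restriction of a tensor to the line through the multi-index `j` in the direction `i`. -/
def tensorSlice [DecidableEq κ] (ψ : τ → ℂ) (j : τ) (i : κ) : σ i → ℂ :=
  fun t => ψ (ι.symm (Function.update (ι j) i t))

theorem tensorSlice_ne_zero [DecidableEq κ] {ψ : τ → ℂ} {j : τ} (hj : ψ j ≠ 0) (i : κ) :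
    tensorSlice ι ψ j i ≠ 0 :=
  Function.ne_iff.mpr ⟨ι j i, by simpa [tensorSlice] using hj⟩

/-- The quadrics that express that exchanging the `i`-th indices of two multi-indices `j, j'`
does not change `ψ_j ψ_{j'}`. -/
def segreQuadrics [DecidableEq κ] : Set (MvPolynomial τ ℂ) :=
  {F | ∃ (j j' : τ) (i : κ), F = MvPolynomial.X j * MvPolynomial.X j' -
    MvPolynomial.X (ι.symm (Function.update (ι j) i (ι j' i))) *
      MvPolynomial.X (ι.symm (Function.update (ι j') i (ι j i)))}

theorem isForm_of_mem_segreQuadrics [DecidableEq κ] {F : MvPolynomial τ ℂ}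
    (hF : F ∈ segreQuadrics ι) : IsForm F := by
  obtain ⟨j, j', i, rfl⟩ := hF
  exact ⟨2, ((MvPolynomial.isHomogeneous_X ℂ _).mul (MvPolynomial.isHomogeneous_X ℂ _)).sub
    ((MvPolynomial.isHomogeneous_X ℂ _).mul (MvPolynomial.isHomogeneous_X ℂ _))⟩

variable [Fintype κ]

theorem segreTensor_ne_zero {u : ∀ i, σ i → ℂ} (hu : ∀ i, u i ≠ 0) : segreTensor ι u ≠ 0 := by
  choose j hj using fun i => Function.ne_iff.mp (hu i)
  refine Function.ne_iff.mpr ⟨ι.symm j, ?_⟩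
  simpa [segreTensor, Finset.prod_ne_zero_iff] using hj

theorem ne_zero_of_segreTensor_ne_zero {u : ∀ i, σ i → ℂ} (h : segreTensor ι u ≠ 0) (i : κ) :
    u i ≠ 0 := by
  rintro hi
  apply h
  ext j
  exact Finset.prod_eq_zero (Finset.mem_univ i) (by rw [hi]; rfl)

theorem segreTensor_smul (c : κ → ℂ) (u : ∀ i, σ i → ℂ) :
    segreTensor ι (fun i => c i • u i) = (∏ i, c i) • segreTensor ι u := by
  ext j
  simp [segreTensor, Finset.prod_mul_distrib]

/-- The Segre map `([u_i])_i ↦ [⨂ u_i]`. -/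
noncomputable def segreMap (y : ∀ i, PSpace (σ i)) : PSpace τ :=
  Projectivization.mk ℂ (segreTensor ι fun i => (y i).rep)
    (segreTensor_ne_zero ι fun i => (y i).rep_nonzero)

theorem segreMap_mk (u : ∀ i, σ i → ℂ) (hu : ∀ i, u i ≠ 0) :
    segreMap ι (fun i => Projectivization.mk ℂ (u i) (hu i)) =
      Projectivization.mk ℂ (segreTensor ι u) (segreTensor_ne_zero ι hu) := by
  rw [segreMap, Projectivization.mk_eq_mk_iff']
  choose c hc using fun i => Projectivization.exists_smul_eq_mk_rep ℂ (u i) (hu i)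
  refine ⟨∏ i, (c i : ℂ), ?_⟩
  rw [← segreTensor_smul]
  congr 1
  ext1 i
  exact hc i

/-- The image of the Segre map. -/
def segreVariety : Set (PSpace τ) := Set.range (segreMap ι)

theorem mem_segreVariety_iff {x : PSpace τ} :
    x ∈ segreVariety ι ↔ ∃ (u : ∀ i, σ i → ℂ) (h : segreTensor ι u ≠ 0),
      x = Projectivization.mk ℂ _ h := by
  constructor
  · rintro ⟨y, rfl⟩
    exact ⟨_, _, rfl⟩
  · rintro ⟨u, h, rfl⟩
    exact ⟨_, segreMap_mk ι u (ne_zero_of_segreTensor_ne_zero ι h)⟩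

theorem exists_tensorSlice_eq_smul [DecidableEq κ] (u : ∀ i, σ i → ℂ) (j : τ) (i : κ) :
    ∃ c : ℂ, tensorSlice ι (segreTensor ι u) j i = c • u i := by
  refine ⟨∏ i' ∈ Finset.univ.erase i, u i' (ι j i'), ?_⟩
  ext t
  rw [tensorSlice, segreTensor, ← Finset.prod_erase_mul _ _ (Finset.mem_univ i)]
  simp only [Equiv.apply_symm_apply, Function.update_self, Pi.smul_apply, smul_eq_mul]
  congr 1
  exact Finset.prod_congr rfl fun i' hi' => by
    rw [Function.update_of_ne (Finset.ne_of_mem_erase hi')]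

/-- The factors of a decomposable tensor are proportional to its nonzero slices. -/
theorem eq_mk_tensorSlice [DecidableEq κ] {y : ∀ i, PSpace (σ i)} {ψ : τ → ℂ} {hψ : ψ ≠ 0}
    (h : segreMap ι y = Projectivization.mk ℂ ψ hψ) {j : τ} {i : κ}
    (hs : tensorSlice ι ψ j i ≠ 0) : y i = Projectivization.mk ℂ _ hs := by
  obtain ⟨a, ha⟩ := (Projectivization.mk_eq_mk_iff' ℂ _ _ _ _).mp h.symm
  obtain ⟨c, hc⟩ := exists_tensorSlice_eq_smul ι (fun i => (y i).rep) j i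
  rw [← (y i).mk_rep, eq_comm, Projectivization.mk_eq_mk_iff']
  refine ⟨a * c, ?_⟩
  rw [mul_smul, ← hc, ← ha]
  rfl

theorem segreMap_injective : Function.Injective (segreMap ι) := by
  classical
  intro y y' h
  have hy' : segreMap ι y' = Projectivization.mk ℂ _ (segreMap ι y').rep_nonzero :=
    (Projectivization.mk_rep _).symm
  obtain ⟨j, hj⟩ := Function.ne_iff.mp (segreMap ι y').rep_nonzero
  ext1 i
  rw [eq_mk_tensorSlice ι hy' (tensorSlice_ne_zero ι hj i),
    eq_mk_tensorSlice ι (h.trans hy') (tensorSlice_ne_zero ι hj i)]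

/-- The inverse of the Segre map, as a bijection from its image. -/
noncomputable def segreEquiv : segreVariety ι ≃ ∀ i, PSpace (σ i) :=
  (Equiv.ofInjective (segreMap ι) (segreMap_injective ι)).symm

theorem segreEquiv_symm_apply (y : ∀ i, PSpace (σ i)) :
    ((segreEquiv ι).symm y : PSpace τ) = segreMap ι y := rfl

theorem segreMap_segreEquiv (x : segreVariety ι) : segreMap ι (segreEquiv ι x) = x := by
  rw [← segreEquiv_symm_apply, Equiv.symm_apply_apply]

theorem isSegreMap_segreEquiv_symm :
    IsSegreMap ι (fun y => ((segreEquiv ι).symm y : PSpace τ)) :=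
  fun u hu => ⟨segreTensor_ne_zero ι hu, segreMap_mk ι u hu⟩

theorem isBiregular_segreEquiv [DecidableEq κ] : IsBiregular (segreEquiv ι) := by
  refine ⟨fun i x => ?_, fun y => ?_⟩
  · obtain ⟨j, hj⟩ := Function.ne_iff.mp x.1.rep_nonzero
    refine ⟨1, fun t => MvPolynomial.X (ι.symm (Function.update (ι j) i t)),
      fun t => MvPolynomial.isHomogeneous_X ℂ _, ?_, fun z hz => ?_⟩
    · simp only [MvPolynomial.eval_X]
      exact tensorSlice_ne_zero ι hj i
    · simp only [MvPolynomial.eval_X] at hz ⊢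
      refine eq_mk_tensorSlice ι (ψ := z.1.rep) (hψ := z.1.rep_nonzero) ?_ hz
      rw [segreMap_segreEquiv, Projectivization.mk_rep]
  · have heval : ∀ z : ∀ i, PSpace (σ i),
        (fun j => multiEval z (∏ i, MvPolynomial.X ⟨i, ι j i⟩)) =
          segreTensor ι fun i => (z i).rep := by
      intro z
      ext j
      simp [multiEval, segreTensor]
    refine ⟨∑ i, Pi.single i 1, fun j => ∏ i, MvPolynomial.X ⟨i, ι j i⟩, fun j => ?_, ?_,
      fun z hz => ?_⟩
    · exact MvPolynomial.IsWeightedHomogeneous.prod _ _ _ fun i _ =>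
        MvPolynomial.isWeightedHomogeneous_X ℂ _ (⟨i, ι j i⟩ : Σ i, σ i)
    · rw [heval]
      exact segreTensor_ne_zero ι fun i => (y i).rep_nonzero
    · simp only [heval]
      rfl

theorem segreVariety_eq_projZeroLocus [DecidableEq κ] :
    segreVariety ι = projZeroLocus (segreQuadrics ι) := by
  ext x
  constructor
  · rw [mem_segreVariety_iff]
    rintro ⟨u, h, rfl⟩ F hF
    rw [vanishesAt_mk (isForm_of_mem_segreQuadrics ι hF)]
    obtain ⟨j, j', i, rfl⟩ := hF
    simp only [map_sub, map_mul, MvPolynomial.eval_X, segreTensor, ← Finset.prod_mul_distrib,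
      Equiv.apply_symm_apply]
    rw [sub_eq_zero]
    refine Finset.prod_congr rfl fun i' _ => ?_
    by_cases hi : i' = i
    · subst hi
      simp [mul_comm]
    · simp [Function.update_of_ne hi]
  · intro hx
    obtain ⟨j₀, hj₀⟩ := Function.ne_iff.mp x.rep_nonzero
    set ψ := x.rep with hψ
    have hj₀ : ψ j₀ ≠ 0 := hj₀
    have hquad : ∀ (f g : ∀ i, σ i) (i : κ), ψ (ι.symm f) * ψ (ι.symm g) =
        ψ (ι.symm (Function.update f i (g i))) * ψ (ι.symm (Function.update g i (f i))) := by
      intro f g i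
      have h0 := hx _ ⟨ι.symm f, ι.symm g, i, rfl⟩
      simp only [VanishesAt, map_sub, map_mul, MvPolynomial.eval_X, Equiv.apply_symm_apply,
        ← hψ] at h0
      exact sub_eq_zero.mp h0
    -- Replace the indices of `j₀` by those of `f` one at a time.
    have key : ∀ (f : ∀ i, σ i) (s : Finset κ),
        ψ (ι.symm (s.piecewise f (ι j₀))) =
          ψ j₀ * ∏ i ∈ s, tensorSlice ι ψ j₀ i (f i) / ψ j₀ := by
      intro f s
      induction s using Finset.induction_on with
      | empty => simp
      | insert i s his ih =>
        have h1 := hquad ((insert i s).piecewise f (ι j₀)) (ι j₀) i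
        rw [Finset.piecewise_insert, Function.update_idem, Function.update_self] at h1
        rw [Finset.prod_insert his]
        rw [show Function.update (s.piecewise f (ι j₀)) i (ι j₀ i) = s.piecewise f (ι j₀) by
          rw [Function.update_eq_self_iff, Finset.piecewise_eq_of_notMem _ _ _ his],
          Equiv.symm_apply_apply, ih] at h1
        rw [Finset.piecewise_insert]
        have h2 : ψ (ι.symm (Function.update (ι j₀) i (f i))) = tensorSlice ι ψ j₀ i (f i) := rfl
        rw [h2] at h1
        apply mul_right_cancel₀ hj₀
        rw [h1]
        field_simp
    have hdec : ψ = ψ j₀ • segreTensor ι fun i t => tensorSlice ι ψ j₀ i t / ψ j₀ := by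
      ext j
      have := key (ι j) Finset.univ
      rwa [Finset.piecewise_univ, Equiv.symm_apply_apply] at this
    rw [mem_segreVariety_iff]
    refine ⟨fun i t => tensorSlice ι ψ j₀ i t / ψ j₀, ?_, ?_⟩
    · intro h0
      rw [h0, smul_zero] at hdec
      exact x.rep_nonzero hdec
    · refine x.mk_rep.symm.trans ((Projectivization.mk_eq_mk_iff' ℂ _ _ _ _).mpr ?_)
      exact ⟨ψ j₀, hdec.symm⟩

theorem isClosed_segreVariety : IsClosed (segreVariety ι) := by
  classical
  rw [segreVariety_eq_projZeroLocus]
  exact isClosed_projZeroLocus fun F hF => isForm_of_mem_segreQuadrics ι hF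

end Segre

/-! ### The Hilbert function of the Segre variety -/

section SegreHilbert

variable {κ : Type} {σ : κ → Type} {τ : Type} (ι : τ ≃ ∀ i, σ i)

/-- The exponent of the monomial of multidegree `(m, …, m)` that is the product of the given
monomials of degree `m` in each group of variables. -/
noncomputable def multiExponent [Finite (Σ i, σ i)] {m : ℕ} (s : ∀ i, Sym (σ i) m) :
    (Σ i, σ i) →₀ ℕ :=
  open Classical in
  Finsupp.equivFunOnFinite.symm fun p => Multiset.count p.2 (s p.1 : Multiset (σ p.1))

theorem multiExponent_injective [Finite (Σ i, σ i)] (m : ℕ) :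
    Function.Injective (multiExponent (σ := σ) (m := m)) := by
  classical
  intro s s' h
  ext i : 1
  refine Subtype.ext (Multiset.ext.mpr fun x => ?_)
  simpa [multiExponent] using DFunLike.congr_fun h (⟨i, x⟩ : Σ i, σ i)

/-- Multisets of equal cardinality in each `σ i` are the marginals of a multiset of multi-indices:
list their elements and read the lists in parallel. -/
theorem exists_multiset_of_marginals {m : ℕ} (s : ∀ i, Sym (σ i) m) :
    ∃ M : Multiset τ, M.card = m ∧ ∀ i, M.map (fun j => ι j i) = s i := by
  have h : ∀ i, ∃ f : Fin m → σ i, (List.ofFn f : Multiset (σ i)) = s i := by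
    intro i
    obtain ⟨s, hs⟩ := s i
    induction s using Quotient.inductionOn with
    | _ l =>
      have hl : l.length = m := hs
      subst hl
      exact ⟨l.get, by simp⟩
  choose f hf using h
  refine ⟨List.ofFn fun t => ι.symm fun i => f i t, by simp, fun i => ?_⟩
  rw [← hf i, Multiset.map_coe, List.map_ofFn]
  congr 2
  ext t
  simp

variable [Fintype κ]

/-- The homomorphism of coordinate rings which corresponds to the Segre map. -/
noncomputable def segrePullback : MvPolynomial τ ℂ →ₐ[ℂ] MvPolynomial (Σ i, σ i) ℂ :=
  MvPolynomial.aeval fun j => ∏ i, MvPolynomial.X ⟨i, ι j i⟩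

theorem eval_segrePullback (t : (Σ i, σ i) → ℂ) (F : MvPolynomial τ ℂ) :
    MvPolynomial.eval t (segrePullback ι F) =
      MvPolynomial.eval (segreTensor ι fun i x => t ⟨i, x⟩) F := by
  rw [segrePullback, eval_aeval_eq]
  simp only [map_prod, MvPolynomial.eval_X]
  rfl

theorem segrePullback_eq_zero_iff [∀ i, Nonempty (σ i)] {F : MvPolynomial τ ℂ} (hF : IsForm F) :
    segrePullback ι F = 0 ↔ ∀ x ∈ segreVariety ι, VanishesAt F x := by
  constructor
  · intro h x hx
    obtain ⟨u, hu, rfl⟩ := (mem_segreVariety_iff ι).mp hx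
    rw [vanishesAt_mk hF]
    have := eval_segrePullback ι (fun s => u s.1 s.2) F
    rw [h, map_zero] at this
    exact this.symm
  · intro h
    refine MvPolynomial.funext_set (fun _ => {z : ℂ | z ≠ 0})
      (fun _ => (Set.finite_singleton (0 : ℂ)).infinite_compl) fun t ht => ?_
    rw [map_zero, eval_segrePullback]
    have hne : segreTensor ι (fun i x => t ⟨i, x⟩) ≠ 0 :=
      segreTensor_ne_zero ι fun i => Function.ne_iff.mpr
        ⟨Classical.arbitrary _, ht ⟨i, Classical.arbitrary _⟩ trivial⟩
    exact (vanishesAt_mk hF _ hne).mp (h _ ((mem_segreVariety_iff ι).mpr ⟨_, hne, rfl⟩))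

theorem monomial_multiExponent [∀ i, Fintype (σ i)] {m : ℕ} (s : ∀ i, Sym (σ i) m) :
    MvPolynomial.monomial (multiExponent s) (1 : ℂ) =
      ∏ i, ((s i : Multiset (σ i)).map fun x => MvPolynomial.X ⟨i, x⟩).prod := by
  classical
  rw [MvPolynomial.monomial_eq, map_one, one_mul, Finsupp.prod_fintype _ _ (by simp),
    Fintype.prod_sigma]
  refine Finset.prod_congr rfl fun i _ => ?_
  rw [Finset.prod_multiset_map_count]
  symm
  refine Finset.prod_subset_one_on_sdiff (Finset.subset_univ _) ?_ ?_
  · intro x hx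
    rw [Finset.mem_sdiff, Multiset.mem_toFinset] at hx
    simp [multiExponent, Multiset.count_eq_zero_of_notMem hx.2]
  · intro x _
    simp only [multiExponent, Finsupp.equivFunOnFinite_symm_apply_apply]

theorem segrePullback_monomial (μ : τ →₀ ℕ) :
    segrePullback ι (MvPolynomial.monomial μ 1) =
      ∏ i, ((Finsupp.toMultiset μ).map fun j => MvPolynomial.X ⟨i, ι j i⟩).prod := by
  rw [← Multiset.prod_map_prod, segrePullback, MvPolynomial.aeval_monomial, map_one, one_mul,
    Finsupp.toMultiset_map, Finsupp.prod_toMultiset, Finsupp.prod_mapDomain_index]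
  · simp
  · simp [pow_add]

/-- The degree `m` part of the homogeneous coordinate ring of the Segre variety has a basis
formed by the monomials of multidegree `(m, …, m)`. -/
theorem hilbertFunction_segreVariety [∀ i, Fintype (σ i)] [∀ i, Nonempty (σ i)] (m : ℕ) :
    hilbertFunction (segreVariety ι) m = ∏ i, (Fintype.card (σ i)).multichoose m := by
  classical
  let pull : MvPolynomial.homogeneousSubmodule τ ℂ m →ₗ[ℂ] MvPolynomial (Σ i, σ i) ℂ :=
    (segrePullback ι).toLinearMap.comp (Submodule.subtype _)
  have hpull : ∀ F : MvPolynomial.homogeneousSubmodule τ ℂ m,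
    pull F = segrePullback ι (F : MvPolynomial τ ℂ) := fun _ => rfl
  have hker : LinearMap.ker pull = vanishingForms (segreVariety ι) m := by
    ext F
    exact segrePullback_eq_zero_iff ι ⟨m, F.2⟩
  have hrange : LinearMap.range pull = Submodule.span ℂ (Set.range
      fun s : ∀ i, Sym (σ i) m => MvPolynomial.monomial (multiExponent s) (1 : ℂ)) := by
    apply le_antisymm
    · rintro _ ⟨F, rfl⟩
      rw [hpull, (F : MvPolynomial τ ℂ).as_sum, map_sum]
      refine Submodule.sum_mem _ fun μ hμ => ?_
      rw [← mul_one (MvPolynomial.coeff μ _), ← smul_eq_mul, ← MvPolynomial.smul_monomial,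
        map_smul]
      refine Submodule.smul_mem _ _ (Submodule.subset_span ?_)
      have hdeg : (Finsupp.toMultiset μ).card = m := by
        have h1 := F.2 (MvPolynomial.mem_support_iff.mp hμ)
        rw [Finsupp.card_toMultiset, ← h1]
        simp [Finsupp.weight_apply, Finsupp.sum]
      refine ⟨fun i => ⟨(Finsupp.toMultiset μ).map fun j => ι j i, by simpa using hdeg⟩, ?_⟩
      rw [segrePullback_monomial]
      refine (monomial_multiExponent _).trans ?_
      simp only [Sym.coe_mk, Multiset.map_map]
      rfl
    · rw [Submodule.span_le]
      rintro _ ⟨s, rfl⟩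
      obtain ⟨M, hM, hMs⟩ := exists_multiset_of_marginals ι s
      refine ⟨⟨MvPolynomial.monomial (Multiset.toFinsupp M) 1,
        MvPolynomial.isHomogeneous_monomial _ ?_⟩, ?_⟩
      · rw [← hM]
        conv_rhs => rw [← Multiset.toFinsupp_toMultiset M, Finsupp.card_toMultiset]
        simp [Finsupp.degree_apply, Finsupp.sum]
      · simp only [hpull, segrePullback_monomial, Multiset.toFinsupp_toMultiset,
          monomial_multiExponent, ← hMs, Multiset.map_map]
        rfl
  have hli : LinearIndependent ℂ
      fun s : ∀ i, Sym (σ i) m => MvPolynomial.monomial (multiExponent s) (1 : ℂ) := by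
    have := (MvPolynomial.basisMonomials (Σ i, σ i) ℂ).linearIndependent.comp _
      (multiExponent_injective (σ := σ) m)
    simpa [Function.comp_def] using this
  rw [hilbertFunction, ← hker, (LinearMap.quotKerEquivRange pull).finrank_eq, hrange,
    finrank_span_eq_card hli, Fintype.card_pi]
  exact Finset.prod_congr rfl fun i _ => Sym.card_sym_eq_multichoose _ _

end SegreHilbert

/-! ### Dimension and degree of the Segre variety -/

section SegreDimension

variable {κ : Type} [Fintype κ] {N : κ → ℕ} {τ : Type} (ι : τ ≃ ∀ i, Fin (N i))

/-- The image under the Segre map of a product of coordinate subspaces, the `i`-th of which is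
spanned by the basis vectors `0, …, c i`. -/
def segreCell (c : ∀ i, Fin (N i)) : Set (PSpace τ) :=
  segreVariety ι ∩ projZeroLocus {F | ∃ j, ¬ ι j ≤ c ∧ F = MvPolynomial.X j}

theorem isClosed_segreCell (c : ∀ i, Fin (N i)) : IsClosed (segreCell ι c) := by
  refine (isClosed_segreVariety ι).inter (isClosed_projZeroLocus ?_)
  rintro _ ⟨j, -, rfl⟩
  exact ⟨1, MvPolynomial.isHomogeneous_X ℂ j⟩

theorem mk_segreTensor_mem_segreCell_iff (c : ∀ i, Fin (N i)) {u : ∀ i, Fin (N i) → ℂ}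
    (h : segreTensor ι u ≠ 0) :
    Projectivization.mk ℂ _ h ∈ segreCell ι c ↔ ∀ j, ¬ ι j ≤ c → segreTensor ι u j = 0 := by
  have hX : ∀ j, VanishesAt (MvPolynomial.X j) (Projectivization.mk ℂ _ h) ↔
      segreTensor ι u j = 0 := fun j => by
    rw [vanishesAt_mk ⟨1, MvPolynomial.isHomogeneous_X ℂ j⟩, MvPolynomial.eval_X]
  constructor
  · intro hx j hj
    exact (hX j).mp (hx.2 _ ⟨j, hj, rfl⟩)
  · intro hx
    refine ⟨(mem_segreVariety_iff ι).mpr ⟨u, h, rfl⟩, ?_⟩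
    rintro _ ⟨j, hj, rfl⟩
    exact (hX j).mpr (hx j hj)

theorem isIrreducible_segreCell (c : ∀ i, Fin (N i)) : IsIrreducible (segreCell ι c) := by
  classical
  let Φ : τ → MvPolynomial (Σ i, Fin (N i)) ℂ :=
    fun j => ∏ i, if ι j i ≤ c i then MvPolynomial.X ⟨i, ι j i⟩ else 0
  have hΦ : ∀ t : (Σ i, Fin (N i)) → ℂ, (fun j => MvPolynomial.eval t (Φ j)) =
      segreTensor ι fun i x => if x ≤ c i then t ⟨i, x⟩ else 0 := by
    intro t
    ext j
    simp only [Φ, segreTensor, map_prod]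
    refine Finset.prod_congr rfl fun i _ => ?_
    split_ifs <;> simp
  have h := isIrreducible_of_polynomial_parametrization Φ (fun _ => 1) (by
    rw [hΦ]
    exact segreTensor_ne_zero ι fun i => Function.ne_iff.mpr ⟨c i, by simp⟩)
  convert h using 1
  ext x
  constructor
  · intro hx
    obtain ⟨u, hu, rfl⟩ := (mem_segreVariety_iff ι).mp hx.1
    rw [mk_segreTensor_mem_segreCell_iff] at hx
    have h0 : (fun j => MvPolynomial.eval (fun s : Σ i, Fin (N i) => u s.1 s.2) (Φ j)) =
        segreTensor ι u := by
      rw [hΦ]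
      ext j
      by_cases hj : ι j ≤ c
      · exact Finset.prod_congr rfl fun i _ => if_pos (hj i)
      · rw [hx j hj]
        obtain ⟨i, hi⟩ := not_forall.mp hj
        exact Finset.prod_eq_zero (Finset.mem_univ i) (by simp [hi])
    refine ⟨fun s => u s.1 s.2, by rwa [h0], ?_⟩
    simp only [h0]
  · rintro ⟨t, ht, rfl⟩
    simp only [hΦ] at ht ⊢
    rw [mk_segreTensor_mem_segreCell_iff]
    intro j hj
    obtain ⟨i, hi⟩ := not_forall.mp hj
    exact Finset.prod_eq_zero (Finset.mem_univ i) (by simp [hi])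

theorem segreCell_strictMono : StrictMono (segreCell ι) := by
  classical
  intro c c' hc
  refine ⟨?_, fun hsub => ?_⟩
  · rintro x ⟨hx, hxc⟩
    refine ⟨hx, ?_⟩
    rintro _ ⟨j, hj, rfl⟩
    exact hxc _ ⟨j, fun h => hj (h.trans hc.le), rfl⟩
  · -- The coordinate point with multi-index `c'` lies in the larger set only.
    have hu : ∀ i, (Pi.single (c' i) 1 : Fin (N i) → ℂ) ≠ 0 := fun i => by simp
    have h1 := (mk_segreTensor_mem_segreCell_iff ι c' (segreTensor_ne_zero ι hu)).mpr (by
      intro j hj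
      obtain ⟨i, hi⟩ := not_forall.mp hj
      exact Finset.prod_eq_zero (Finset.mem_univ i)
        (Pi.single_eq_of_ne (fun h => hi h.le) _))
    have h2 := (mk_segreTensor_mem_segreCell_iff ι c (segreTensor_ne_zero ι hu)).mp (hsub h1)
      (ι.symm c') (by simpa using hc.not_ge)
    simp [segreTensor] at h2

theorem sum_le_topologicalKrullDim_segreVariety (hN : ∀ i, 0 < N i) :
    ((∑ i, (N i - 1) : ℕ) : WithBot ℕ∞) ≤ topologicalKrullDim (segreVariety ι) := by
  let f : (∀ i, Fin (N i)) → TopologicalSpace.IrreducibleCloseds (segreVariety ι) := fun c =>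
    { carrier := (↑) ⁻¹' segreCell ι c
      isIrreducible' := (isIrreducible_segreCell ι c).preimage_subtypeVal Set.inter_subset_left
      isClosed' := (isClosed_segreCell ι c).preimage continuous_subtype_val }
  have hf : StrictMono f := by
    intro c c' hc
    obtain ⟨h1, h2⟩ := segreCell_strictMono ι hc
    refine ⟨fun x hx => h1 hx, fun h => h2 fun x hx => ?_⟩
    exact h (show (⟨x, hx.1⟩ : segreVariety ι) ∈ f c' from hx)
  exact sum_le_krullDim_of_strictMono f hf fun i => ⟨N i - 1, Nat.sub_lt (hN i) one_pos⟩

theorem multichoose_eq_choose_pred {N : ℕ} (hN : 0 < N) (m : ℕ) :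
    N.multichoose m = (m + (N - 1)).choose (N - 1) := by
  rw [Nat.multichoose_eq, show N + m - 1 = m + (N - 1) by omega, Nat.choose_symm_add]

theorem hilbertFunction_segreVariety_le (hN : ∀ i, 0 < N i) (m : ℕ) :
    hilbertFunction (segreVariety ι) m ≤
      (∏ i, N i ^ (N i - 1)) * (m + 1) ^ ∑ i, (N i - 1) := by
  have : ∀ i, Nonempty (Fin (N i)) := fun i => ⟨⟨0, hN i⟩⟩
  rw [hilbertFunction_segreVariety, ← Finset.prod_pow_eq_pow_sum, ← Finset.prod_mul_distrib]
  refine Finset.prod_le_prod' fun i _ => ?_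
  rw [Fintype.card_fin, multichoose_eq_choose_pred (hN i), ← mul_pow]
  refine (Nat.choose_le_pow _ _).trans (Nat.pow_le_pow_left ?_ _)
  have := hN i
  nlinarith [Nat.sub_add_cancel (hN i), Nat.zero_le (m * (N i - 1))]

theorem topologicalKrullDim_segreVariety (hN : ∀ i, 0 < N i) :
    topologicalKrullDim (segreVariety ι) = ((∑ i, (N i - 1) : ℕ) : WithBot ℕ∞) := by
  classical
  have : Finite τ := Finite.of_equiv _ ι.symm
  exact le_antisymm
    (topologicalKrullDim_le_of_hilbertFunction_le (isClosed_segreVariety ι)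
      (hilbertFunction_segreVariety_le ι hN))
    (sum_le_topologicalKrullDim_segreVariety ι hN)

theorem hasDegree_segreVariety (hN : ∀ i, 0 < N i) :
    HasDegree (segreVariety ι)
      (((∑ i, (N i - 1))! : ℕ) / (∏ i, (N i - 1)! : ℕ) : ℚ) := by
  have : ∀ i, Nonempty (Fin (N i)) := fun i => ⟨⟨0, hN i⟩⟩
  have hlead : (∏ i, Polynomial.preHilbertPoly ℚ (N i - 1) 0).leadingCoeff =
      (((∏ i, (N i - 1)! : ℕ)) : ℚ)⁻¹ := by
    rw [Polynomial.leadingCoeff_prod]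
    simp [Polynomial.leadingCoeff_preHilbertPoly]
  have hdeg : (∏ i, Polynomial.preHilbertPoly ℚ (N i - 1) 0).natDegree = ∑ i, (N i - 1) := by
    rw [Polynomial.natDegree_prod]
    · simp [Polynomial.natDegree_preHilbertPoly]
    · intro i _
      rw [← Polynomial.leadingCoeff_ne_zero, Polynomial.leadingCoeff_preHilbertPoly]
      exact inv_ne_zero (Nat.cast_ne_zero.mpr (Nat.factorial_ne_zero _))
  refine ⟨∏ i, Polynomial.preHilbertPoly ℚ (N i - 1) 0, ?_, ?_, ?_⟩
  · refine Filter.Eventually.of_forall fun m => ?_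
    rw [hilbertFunction_segreVariety, Polynomial.eval_prod, Nat.cast_prod]
    refine Finset.prod_congr rfl fun i _ => ?_
    rw [Polynomial.preHilbertPoly_eq_choose_sub_add ℚ _ (Nat.zero_le m), Fintype.card_fin,
      multichoose_eq_choose_pred (hN i), Nat.sub_zero]
  · rw [hdeg, topologicalKrullDim_segreVariety ι hN]
  · rw [hdeg, hlead, div_eq_mul_inv]

end SegreDimension

/-! ### Tensor trains and partitions of the vertices -/

section TensorTrain

variable {n : ℕ} {k : Fin (n + 1) → ℕ} {r : Fin (n + 2) → ℕ}

/-- The partial product `M_0 ⋯ M_{i-1}`. -/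
noncomputable def ttPrefix (M : ∀ v : Fin (n + 1), Matrix (Fin (r v.castSucc)) (Fin (r v.succ)) ℂ)
    (i : Fin (n + 2)) : Matrix (Fin (r 0)) (Fin (r i)) ℂ :=
  Fin.induction (motive := fun i => Matrix (Fin (r 0)) (Fin (r i)) ℂ) 1 (fun v P => P * M v) i

/-- The row vector `(1, …, 1) M_0 ⋯ M_{i-1}`; for `r 0 = 1` it is the partial product itself. -/
noncomputable def ttState (M : ∀ v : Fin (n + 1), Matrix (Fin (r v.castSucc)) (Fin (r v.succ)) ℂ)
    (i : Fin (n + 2)) (b : Fin (r i)) : ℂ :=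
  ∑ a, ttPrefix M i a b

theorem ttState_zero (M : ∀ v : Fin (n + 1), Matrix (Fin (r v.castSucc)) (Fin (r v.succ)) ℂ)
    (b : Fin (r 0)) : ttState M 0 b = 1 := by
  simp [ttState, ttPrefix, Matrix.one_apply]

theorem ttState_succ (M : ∀ v : Fin (n + 1), Matrix (Fin (r v.castSucc)) (Fin (r v.succ)) ℂ)
    (v : Fin (n + 1)) (b : Fin (r v.succ)) :
    ttState M v.succ b = ∑ x, ttState M v.castSucc x * M v x b := by
  have h : ttPrefix M v.succ = ttPrefix M v.castSucc * M v := by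
    rw [ttPrefix, Fin.induction_succ]
    rfl
  simp only [ttState, h, Matrix.mul_apply, Finset.sum_mul]
  exact Finset.sum_comm

theorem ttTensor_eq_sum_ttState (A : TTCores k r) (j : TIndex k) :
    ttTensor A j = ∑ b, ttState (fun v => A v (j v)) (Fin.last (n + 1)) b :=
  Finset.sum_comm

/-- The cores which agree with `A` at the vertices of the part `p`, and which at every other
vertex are the matrix whose first row is `(1, …, 1)` and whose other rows vanish. The latter
matrices map a row vector `s` to the constant vector with entry `s 0`. -/
noncomputable def maskedCores {κ : Type} [DecidableEq κ] (part : Fin (n + 1) → κ) (p : κ)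
    (A : TTCores k r) : TTCores k r :=
  fun v j => if part v = p then A v j else Matrix.of fun x _ => if (x : ℕ) = 0 then 1 else 0

variable {κ : Type} [DecidableEq κ] {part : Fin (n + 1) → κ}

theorem ttState_maskedCores_succ_of_eq (A : TTCores k r) (j : TIndex k) {v : Fin (n + 1)} {p : κ}
    (hv : part v = p) (b : Fin (r v.succ)) :
    ttState (fun v => maskedCores part p A v (j v)) v.succ b =
      ∑ x, ttState (fun v => maskedCores part p A v (j v)) v.castSucc x * A v (j v) x b := by
  rw [ttState_succ]
  simp [maskedCores, hv]

theorem ttState_maskedCores_succ_of_ne (hr : ∀ i, 0 < r i) (A : TTCores k r) (j : TIndex k)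
    {v : Fin (n + 1)} {p : κ} (hv : part v ≠ p) (b : Fin (r v.succ)) :
    ttState (fun v => maskedCores part p A v (j v)) v.succ b =
      ttState (fun v => maskedCores part p A v (j v)) v.castSucc ⟨0, hr _⟩ := by
  rw [ttState_succ, Finset.sum_eq_single ⟨0, hr _⟩]
  · simp [maskedCores, hv]
  · intro x _ hx
    have : (x : ℕ) ≠ 0 := fun h => hx (Fin.ext h)
    simp [maskedCores, hv, this]
  · simp

/-- If the bond in front of `v` has dimension one whenever it leads to a different part, the state
in front of `v` of a chain masked to a part that does not contain `v` is constant. -/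
theorem ttState_maskedCores_const (hr : ∀ i, 0 < r i)
    (hpart : ∀ w v : Fin (n + 1), w.succ = v.castSucc → r w.succ ≠ 1 → part w = part v)
    (A : TTCores k r) (j : TIndex k) {v : Fin (n + 1)} {p : κ} (hv : part v ≠ p)
    (b b' : Fin (r v.castSucc)) :
    ttState (fun v => maskedCores part p A v (j v)) v.castSucc b =
      ttState (fun v => maskedCores part p A v (j v)) v.castSucc b' := by
  have key : ∀ i : Fin (n + 2), i = v.castSucc → ∀ b b' : Fin (r i),
      ttState (fun v => maskedCores part p A v (j v)) i b =
        ttState (fun v => maskedCores part p A v (j v)) i b' := by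
    intro i
    induction i using Fin.cases with
    | zero =>
      intro _ b b'
      rw [ttState_zero, ttState_zero]
    | succ w =>
      intro hw b b'
      by_cases h1 : r w.succ = 1
      · have : Subsingleton (Fin (r w.succ)) := by
          rw [h1]
          infer_instance
        rw [Subsingleton.elim b b']
      · have hwp : part w ≠ p := by rwa [hpart w v hw h1]
        rw [ttState_maskedCores_succ_of_ne hr A j hwp, ttState_maskedCores_succ_of_ne hr A j hwp]
  exact key _ rfl b b'

theorem ttState_eq_prod_maskedCores [Fintype κ] (hr : ∀ i, 0 < r i)
    (hpart : ∀ w v : Fin (n + 1), w.succ = v.castSucc → r w.succ ≠ 1 → part w = part v)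
    (A : TTCores k r) (j : TIndex k) (i : Fin (n + 2)) (b : Fin (r i)) :
    ttState (fun v => A v (j v)) i b =
      ∏ p, ttState (fun v => maskedCores part p A v (j v)) i b := by
  induction i using Fin.induction with
  | zero => simp [ttState_zero]
  | succ v ih =>
    rw [ttState_succ, ← Finset.mul_prod_erase _ _ (Finset.mem_univ (part v)),
      ttState_maskedCores_succ_of_eq A j rfl, Finset.sum_mul]
    refine Finset.sum_congr rfl fun x _ => ?_
    rw [ih, ← Finset.mul_prod_erase _ _ (Finset.mem_univ (part v)), mul_right_comm]
    congr 1
    refine Finset.prod_congr rfl fun p hp => ?_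
    have hp : part v ≠ p := (Finset.ne_of_mem_erase hp).symm
    rw [ttState_maskedCores_succ_of_ne hr A j hp]
    exact ttState_maskedCores_const hr hpart A j hp _ _

/-- If the vertices are divided into parts and all bonds between different parts have dimension
one, a tensor train is the product of its restrictions to the parts. -/
theorem ttTensor_eq_prod_maskedCores [Fintype κ] (hr : ∀ i, 0 < r i)
    (hr_last : r (Fin.last (n + 1)) = 1)
    (hpart : ∀ w v : Fin (n + 1), w.succ = v.castSucc → r w.succ ≠ 1 → part w = part v)
    (A : TTCores k r) (j : TIndex k) :
    ttTensor A j = ∏ p, ttTensor (maskedCores part p A) j := by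
  have : Unique (Fin (r (Fin.last (n + 1)))) := by
    rw [hr_last]
    infer_instance
  simp only [ttTensor_eq_sum_ttState, Fintype.sum_unique]
  exact ttState_eq_prod_maskedCores hr hpart A j _ _

theorem ttTensor_maskedCores_congr (A : TTCores k r) {p : κ} {j j' : TIndex k}
    (h : ∀ v, part v = p → j v = j' v) :
    ttTensor (maskedCores part p A) j = ttTensor (maskedCores part p A) j' := by
  have : (fun v => maskedCores part p A v (j v)) = fun v => maskedCores part p A v (j' v) := by
    ext1 v
    by_cases hv : part v = p
    · rw [h v hv]
    · simp [maskedCores, hv]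
  simp only [ttTensor_eq_sum_ttState, this]

/-- A pairing map for encoding multi-indices: injective on demand, and otherwise zero. -/
theorem exists_pairing {a b c : ℕ} (hc : 0 < c) (P : Prop) (h : P → a * b ≤ c) :
    ∃ f : Fin a → Fin b → Fin c, (P → Function.Injective2 f) ∧ (¬ P → ∀ x y, f x y = ⟨0, hc⟩) := by
  by_cases hP : P
  · refine ⟨fun x y => Fin.castLE (h hP) (finProdFinEquiv (x, y)), fun _ => ?_,
      fun h => absurd hP h⟩
    intro x x' y y' hxy
    have := finProdFinEquiv.injective (Fin.castLE_injective (h hP) hxy)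
    exact Prod.mk.inj this
  · exact ⟨fun _ _ => ⟨0, hc⟩, fun h => absurd h hP, fun _ _ _ => rfl⟩

/-- Every function of the indices in the part `p` is a tensor train masked to `p`, if the bond
dimensions are large enough: the cores in front of the pivot `c` encode all indices read so far
in the state, the cores after `c` do the same from the other end, and the core at `c` looks up
the value of the function. -/
theorem exists_ttTensor_maskedCores_eq (hr : ∀ i, 0 < r i)
    (hr_first : r 0 = 1) (hr_last : r (Fin.last (n + 1)) = 1)
    (hpart : ∀ w v : Fin (n + 1), w.succ = v.castSucc → r w.succ ≠ 1 → part w = part v)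
    {p : κ} {c : Fin (n + 1)} (hc : part c = p)
    (hconvL : ∀ v w, part v = p → v ≤ w → w ≤ c → part w = p)
    (hconvR : ∀ v w, part v = p → c ≤ w → w ≤ v → part w = p)
    (hL : ∀ v, part v = p → v < c → r v.castSucc * k v ≤ r v.succ)
    (hR : ∀ v, part v = p → c < v → r v.succ * k v ≤ r v.castSucc)
    (w : TIndex k → ℂ) (hw : ∀ j j', (∀ v, part v = p → j v = j' v) → w j = w j') :
    ∃ A : TTCores k r, ∀ j, ttTensor (maskedCores part p A) j = w j := by
  classical
  choose fL hfL using fun v : Fin (n + 1) =>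
    exists_pairing (a := r v.castSucc) (b := k v) (hr v.succ) (part v = p ∧ v < c)
      (fun h => hL v h.1 h.2)
  choose fR hfR using fun v : Fin (n + 1) =>
    exists_pairing (a := r v.succ) (b := k v) (hr v.castSucc) (part v = p ∧ c < v)
      (fun h => hR v h.1 h.2)
  obtain ⟨encL, hencL⟩ : ∃ e : ∀ i : Fin (n + 2), TIndex k → Fin (r i),
      ∀ v J, e v.succ J = fL v (e v.castSucc J) (J v) :=
    ⟨fun i => Fin.induction (motive := fun i => TIndex k → Fin (r i)) (fun _ => ⟨0, hr 0⟩)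
      (fun v f J => fL v (f J) (J v)) i, fun v J => by simp only [Fin.induction_succ]⟩
  obtain ⟨encR, hencR⟩ : ∃ e : ∀ i : Fin (n + 2), TIndex k → Fin (r i),
      ∀ v J, e v.castSucc J = fR v (e v.succ J) (J v) :=
    ⟨fun i => Fin.reverseInduction (motive := fun i => TIndex k → Fin (r i))
      (fun _ => ⟨0, hr _⟩) (fun v f J => fR v (f J) (J v)) i,
      fun v J => by simp only [Fin.reverseInduction_castSucc]⟩
  have injL : ∀ (i : Fin (n + 2)) (J J' : TIndex k), i ≤ c.castSucc → encL i J = encL i J' →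
      ∀ v, v.castSucc < i → part v = p → J v = J' v := by
    intro i J J'
    induction i using Fin.induction with
    | zero => exact fun _ _ v hv => absurd hv (Fin.not_lt_zero _)
    | succ u ih =>
      intro hu h v hv hvp
      have hvu : v ≤ u := Fin.castSucc_lt_succ_iff.mp hv
      have huc : u < c := Fin.succ_le_castSucc_iff.mp hu
      rw [hencL, hencL] at h
      obtain ⟨h1, h2⟩ := (hfL u).1 ⟨hconvL v u hvp hvu huc.le, huc⟩ h
      rcases hvu.eq_or_lt with rfl | hlt
      · exact h2
      · exact ih (Fin.castSucc_le_castSucc_iff.mpr huc.le) h1 v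
          (Fin.castSucc_lt_castSucc_iff.mpr hlt) hvp
  have injR : ∀ (i : Fin (n + 2)) (J J' : TIndex k), c.succ ≤ i → encR i J = encR i J' →
      ∀ v, i ≤ v.castSucc → part v = p → J v = J' v := by
    intro i J J'
    induction i using Fin.reverseInduction with
    | last => exact fun _ _ v hv => absurd (hv.trans_lt (Fin.castSucc_lt_last v)) (lt_irrefl _)
    | cast u ih =>
      intro hu h v hv hvp
      have hvu : u ≤ v := Fin.castSucc_le_castSucc_iff.mp hv
      have huc : c < u := Fin.succ_le_castSucc_iff.mp hu
      rw [hencR, hencR] at h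
      obtain ⟨h1, h2⟩ := (hfR u).1 ⟨hconvR v u hvp huc.le hvu, huc⟩ h
      rcases hvu.eq_or_lt with rfl | hlt
      · exact h2
      · exact ih (Fin.succ_le_succ_iff.mpr huc.le) h1 v (Fin.succ_le_castSucc_iff.mpr hlt) hvp
  have congrL : ∀ (i : Fin (n + 2)) (J J' : TIndex k),
      (∀ v, v.castSucc < i → J v = J' v) → encL i J = encL i J' := by
    intro i J J'
    induction i using Fin.induction with
    | zero =>
      intro _
      apply Fin.ext
      have h1 := (encL 0 J).isLt
      have h2 := (encL 0 J').isLt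
      omega
    | succ u ih =>
      intro h
      rw [hencL, hencL, h u Fin.castSucc_lt_succ,
        ih fun v hv => h v (hv.trans Fin.castSucc_lt_succ)]
  -- The core at the pivot; it is well defined by `injL` and `injR`.
  obtain ⟨B, hB⟩ : ∃ B : Fin (k c) → Matrix (Fin (r c.castSucc)) (Fin (r c.succ)) ℂ,
      ∀ J, B (J c) (encL c.castSucc J) (encR c.succ J) = w J := by
    refine ⟨fun t x y => if h : ∃ J : TIndex k, J c = t ∧ encL c.castSucc J = x ∧
      encR c.succ J = y then w h.choose else 0, fun J => ?_⟩
    have hex : ∃ J' : TIndex k, J' c = J c ∧ encL c.castSucc J' = encL c.castSucc J ∧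
        encR c.succ J' = encR c.succ J := ⟨J, rfl, rfl, rfl⟩
    simp only [dif_pos hex]
    obtain ⟨h1, h2, h3⟩ := hex.choose_spec
    refine hw _ _ fun v hv => ?_
    rcases lt_trichotomy v c with hvc | rfl | hvc
    · exact injL _ _ _ le_rfl h2 v (Fin.castSucc_lt_castSucc_iff.mpr hvc) hv
    · exact h1
    · exact injR _ _ _ le_rfl h3 v (Fin.succ_le_castSucc_iff.mpr hvc) hv
  let A : TTCores k r := fun v t => if h : v = c then h ▸ B (h ▸ t) else
    Matrix.of fun x y => if v < c then (if y = fL v x t then 1 else 0)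
      else (if x = fR v y t then 1 else 0)
  have hAc : ∀ t, A c t = B t := fun t => by simp [A]
  have hAL : ∀ v t x y, v < c → A v t x y = if y = fL v x t then 1 else 0 := by
    intro v t x y hv
    simp [A, hv.ne, hv]
  have hAR : ∀ v t x y, c < v → A v t x y = if x = fR v y t then 1 else 0 := by
    intro v t x y hv
    simp [A, hv.ne', hv.not_gt]
  refine ⟨A, fun j => ?_⟩
  set S := ttState fun v => maskedCores part p A v (j v) with hS
  have hSeq : ∀ {v : Fin (n + 1)}, part v = p → ∀ b,
      S v.succ b = ∑ x, S v.castSucc x * A v (j v) x b :=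
    fun hv b => ttState_maskedCores_succ_of_eq A j hv b
  have hSne : ∀ {v : Fin (n + 1)}, part v ≠ p → ∀ b, S v.succ b = S v.castSucc ⟨0, hr _⟩ :=
    fun hv b => ttState_maskedCores_succ_of_ne hr A j hv b
  -- In front of the first vertex of the part, all entries of the state are one.
  have hS1 : ∀ i : Fin (n + 2), (∀ v, v.castSucc < i → part v ≠ p) → ∀ b, S i b = 1 := by
    intro i
    induction i using Fin.induction with
    | zero => exact fun _ b => ttState_zero _ b
    | succ u ih =>
      intro h b
      rw [hSne (h u Fin.castSucc_lt_succ)]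
      exact ih (fun v hv => h v (hv.trans Fin.castSucc_lt_succ)) _
  -- In front of the pivot the state is the basis vector which encodes the indices read so far.
  have hSL : ∀ i : Fin (n + 2), (∃ v, v.castSucc = i ∧ part v = p ∧ v ≤ c) →
      ∀ b, S i b = if b = encL i j then 1 else 0 := by
    intro i
    induction i using Fin.induction with
    | zero =>
      intro _ b
      have : b = encL 0 j := by
        apply Fin.ext
        have h1 := (encL 0 j).isLt
        have h2 := b.isLt
        omega
      rw [if_pos this]
      exact ttState_zero _ b
    | succ u ih =>
      rintro ⟨v, hvu, hvp, hvc⟩ b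
      have huv : u < v := Fin.succ_le_castSucc_iff.mp hvu.ge
      by_cases hup : part u = p
      · rw [hSeq hup, Finset.sum_eq_single (encL u.castSucc j)]
        · rw [ih ⟨u, rfl, hup, huv.le.trans hvc⟩, if_pos rfl, one_mul,
            hAL _ _ _ _ (huv.trans_le hvc), hencL]
        · intro x _ hx
          rw [ih ⟨u, rfl, hup, huv.le.trans hvc⟩, if_neg hx, zero_mul]
        · simp
      · have hr1 : r u.succ = 1 := by
          by_contra h1
          exact hup ((hpart u v hvu.symm h1).trans hvp)
        have : b = encL u.succ j := by
          apply Fin.ext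
          have h1 := (encL u.succ j).isLt
          have h2 := b.isLt
          omega
        rw [if_pos this]
        refine hS1 _ (fun v' hv' hvp' => hup ?_) b
        exact hconvL v' u hvp' (Fin.castSucc_lt_succ_iff.mp hv') (huv.le.trans hvc)
  -- Behind the pivot, the entry at the code of the remaining indices is the value of `w`.
  have hSR : ∀ i : Fin (n + 2), c.succ ≤ i → ∀ J : TIndex k,
      (∀ v, v.castSucc < i → J v = j v) → S i (encR i J) = w J := by
    intro i
    induction i using Fin.induction with
    | zero => exact fun h => absurd h (not_le.mpr (Fin.succ_pos c))
    | succ u ih =>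
      intro hcu J hJ
      have hJu : J u = j u := hJ u Fin.castSucc_lt_succ
      have hJlt : ∀ v, v.castSucc < u.castSucc → J v = j v :=
        fun v hv => hJ v (hv.trans Fin.castSucc_lt_succ)
      rcases (Fin.succ_le_succ_iff.mp hcu).eq_or_lt with rfl | hlt
      · rw [hSeq hc, Finset.sum_eq_single (encL c.castSucc j)]
        · rw [hSL _ ⟨c, rfl, hc, le_rfl⟩, if_pos rfl, one_mul, hAc, ← hJu, ← hB J,
            congrL _ J j hJlt]
        · intro x _ hx
          rw [hSL _ ⟨c, rfl, hc, le_rfl⟩, if_neg hx, zero_mul]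
        · simp
      · have hcu' : c.succ ≤ u.castSucc := Fin.succ_le_castSucc_iff.mpr hlt
        have hih := ih hcu' J hJlt
        by_cases hup : part u = p
        · rw [hSeq hup, Finset.sum_eq_single (encR u.castSucc J)]
          · rw [hAR _ _ _ _ hlt, ← hJu, ← hencR, if_pos rfl, mul_one, hih]
          · intro x _ hx
            rw [hAR _ _ _ _ hlt, ← hJu, ← hencR, if_neg hx, mul_zero]
          · simp
        · rw [hSne hup, ← hih, hencR, (hfR u).2 fun h => hup h.1]
  have : Unique (Fin (r (Fin.last (n + 1)))) := by
    rw [hr_last]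
    infer_instance
  rw [ttTensor_eq_sum_ttState, Fintype.sum_unique]
  rw [← hSR (Fin.last (n + 1)) (Fin.le_last _) j fun _ _ => rfl]
  exact congrArg _ (Subsingleton.elim _ _)

theorem exists_ttTensor_eq_prod [Fintype κ] (hr : ∀ i, 0 < r i)
    (hr_first : r 0 = 1) (hr_last : r (Fin.last (n + 1)) = 1)
    (hpart : ∀ w v : Fin (n + 1), w.succ = v.castSucc → r w.succ ≠ 1 → part w = part v)
    {c : κ → Fin (n + 1)} (hc : ∀ p, part (c p) = p)
    (hconvL : ∀ v w, v ≤ w → w ≤ c (part v) → part w = part v)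
    (hconvR : ∀ v w, c (part v) ≤ w → w ≤ v → part w = part v)
    (hL : ∀ v, v < c (part v) → r v.castSucc * k v ≤ r v.succ)
    (hR : ∀ v, c (part v) < v → r v.succ * k v ≤ r v.castSucc)
    (w : κ → TIndex k → ℂ)
    (hw : ∀ p j j', (∀ v, part v = p → j v = j' v) → w p j = w p j') :
    ∃ A : TTCores k r, ∀ j, ttTensor A j = ∏ p, w p j := by
  choose A hA using fun p => exists_ttTensor_maskedCores_eq (k := k) hr hr_first hr_last hpart
    (hc p) (fun v w hv => by subst hv; exact hconvL v w)
    (fun v w hv => by subst hv; exact hconvR v w)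
    (fun v hv => by subst hv; exact hL v) (fun v hv => by subst hv; exact hR v) (w p) (hw p)
  refine ⟨fun v => A (part v) v, fun j => ?_⟩
  rw [ttTensor_eq_prod_maskedCores hr hr_last hpart]
  refine Finset.prod_congr rfl fun p _ => ?_
  rw [← hA p]
  congr 1
  ext v t : 2
  by_cases hv : part v = p
  · subst hv
    simp [maskedCores]
  · simp [maskedCores, hv]

end TensorTrain

/-! ### Tensor train varieties as Segre varieties -/

/-- Grouping the indices of a tensor according to a partition of the vertices. -/
theorem exists_equiv_of_partition {n : ℕ} {κ : Type} [DecidableEq κ] (k : Fin (n + 1) → ℕ)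
    (part : Fin (n + 1) → κ) (N : κ → ℕ)
    (hN : ∀ p, ∏ v ∈ Finset.univ.filter (fun v => part v = p), k v = N p) :
    ∃ ι : TIndex k ≃ ∀ p, Fin (N p),
      ∀ j j' p, ι j p = ι j' p ↔ ∀ v, part v = p → j v = j' v := by
  let e₁ : TIndex k ≃ ∀ p, ∀ v : {v // part v = p}, Fin (k v) :=
    { toFun := fun j p v => j v
      invFun := fun f v => f (part v) ⟨v, rfl⟩
      left_inv := fun j => rfl
      right_inv := fun f => by
        ext p ⟨v, hv⟩
        subst hv
        rfl }
  have hcard : ∀ p, Fintype.card (∀ v : {v // part v = p}, Fin (k v)) = N p := by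
    intro p
    simp only [Fintype.card_pi, Fintype.card_fin]
    rw [← hN p]
    exact (Finset.prod_subtype _ (by simp) k).symm
  let e₂ := fun p => Fintype.equivFinOfCardEq (hcard p)
  refine ⟨e₁.trans (Equiv.piCongrRight e₂), fun j j' p => ?_⟩
  have h : ∀ j : TIndex k, (e₁.trans (Equiv.piCongrRight e₂)) j p = e₂ p (e₁ j p) := fun _ => rfl
  rw [h, h, (e₂ p).apply_eq_iff_eq, funext_iff]
  exact ⟨fun h v hv => h ⟨v, hv⟩, fun h v => h v v.2⟩

/-- If the bonds between different parts have dimension one, and inside each part the bond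
dimensions suffice to carry all indices to the pivot `c p`, the tensor trains are the tensors
which decompose along the partition. -/
theorem ttVariety_eq_segreVariety {n : ℕ} {κ : Type} [Fintype κ] [DecidableEq κ]
    {k : Fin (n + 1) → ℕ} {r : Fin (n + 2) → ℕ} {part : Fin (n + 1) → κ} {N : κ → ℕ}
    (hr : ∀ i, 0 < r i) (hr_first : r 0 = 1) (hr_last : r (Fin.last (n + 1)) = 1)
    (hpart : ∀ w v : Fin (n + 1), w.succ = v.castSucc → r w.succ ≠ 1 → part w = part v)
    {c : κ → Fin (n + 1)} (hc : ∀ p, part (c p) = p)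
    (hconvL : ∀ v w, v ≤ w → w ≤ c (part v) → part w = part v)
    (hconvR : ∀ v w, c (part v) ≤ w → w ≤ v → part w = part v)
    (hL : ∀ v, v < c (part v) → r v.castSucc * k v ≤ r v.succ)
    (hR : ∀ v, c (part v) < v → r v.succ * k v ≤ r v.castSucc)
    (ι : TIndex k ≃ ∀ p, Fin (N p))
    (hι : ∀ j j' p, ι j p = ι j' p ↔ ∀ v, part v = p → j v = j' v) :
    ttVariety k r = segreVariety ι := by
  rw [ttVariety, ← (isClosed_segreVariety ι).closure_eq]
  congr 1
  ext x
  rw [mem_segreVariety_iff]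
  constructor
  · rintro ⟨A, h, rfl⟩
    have hfac : ∀ p, ∃ u : Fin (N p) → ℂ,
        ttTensor (maskedCores part p A) = u ∘ fun j => ι j p := fun p =>
      (Function.factorsThrough_iff _).mp fun j j' hj =>
        ttTensor_maskedCores_congr A ((hι j j' p).mp hj)
    choose u hu using hfac
    have htt : ttTensor A = segreTensor ι u := by
      ext j
      rw [ttTensor_eq_prod_maskedCores hr hr_last hpart]
      exact Finset.prod_congr rfl fun p _ => congrFun (hu p) j
    exact ⟨u, htt ▸ h, by simp only [htt]⟩
  · rintro ⟨u, h, rfl⟩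
    obtain ⟨A, hA⟩ := exists_ttTensor_eq_prod (k := k) hr hr_first hr_last hpart hc hconvL hconvR
      hL hR (fun p j => u p (ι j p)) fun p j j' hj => by rw [(hι j j' p).mpr hj]
    have htt : ttTensor A = segreTensor ι u := funext hA
    exact ⟨A, htt ▸ h, by simp only [htt]⟩

/-! ### Blocks of bonds -/

section Blocks

variable {n l : ℕ} {r : Fin (n + 2) → ℕ} {a b : Fin l → Fin (n + 2)}

/-- The vertices are partitioned into those spanned by each block, and the free ones. -/
theorem IsBlockDecomposition.exists_partition (h : IsBlockDecomposition r a b)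
    (hr : ∀ i, 0 < r i) :
    ∃ part : Fin (n + 1) → Fin l ⊕ FreeVertex r,
      (∀ v p, part v = Sum.inl p ↔ (a p : ℕ) ≤ (v : ℕ) + 1 ∧ (v : ℕ) ≤ (b p : ℕ)) ∧
      ∀ v f, part v = Sum.inr f ↔ v = f.1 := by
  have hblock : ∀ v : Fin (n + 1), ¬ (r v.castSucc = 1 ∧ r v.succ = 1) →
      ∃ p, (a p : ℕ) ≤ (v : ℕ) + 1 ∧ (v : ℕ) ≤ (b p : ℕ) := by
    intro v hv
    have h1 := hr v.castSucc
    have h2 := hr v.succ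
    rcases not_and_or.mp hv with hv | hv
    · obtain ⟨p, hp, hp'⟩ := (h.one_lt_iff v.castSucc).mp (by omega)
      simp only [Fin.le_def, Fin.val_castSucc] at hp hp'
      exact ⟨p, by omega, by omega⟩
    · obtain ⟨p, hp, hp'⟩ := (h.one_lt_iff v.succ).mp (by omega)
      simp only [Fin.le_def, Fin.val_succ] at hp hp'
      exact ⟨p, by omega, by omega⟩
  have hfree : ∀ (v : Fin (n + 1)) p, (a p : ℕ) ≤ (v : ℕ) + 1 → (v : ℕ) ≤ (b p : ℕ) →
      ¬ (r v.castSucc = 1 ∧ r v.succ = 1) := by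
    rintro v p hp hp' ⟨h1, h2⟩
    have hle := Fin.le_def.mp (h.le p)
    by_cases hv : (a p : ℕ) ≤ v
    · have := (h.one_lt_iff v.castSucc).mpr ⟨p, by simpa [Fin.le_def] using hv,
        by simpa [Fin.le_def] using hp'⟩
      omega
    · have := (h.one_lt_iff v.succ).mpr ⟨p, by simpa [Fin.le_def] using hp,
        by simp only [Fin.le_def, Fin.val_succ]; omega⟩
      omega
  have huniq : ∀ (v : Fin (n + 1)) p q, (a p : ℕ) ≤ (v : ℕ) + 1 → (v : ℕ) ≤ (b p : ℕ) →
      (a q : ℕ) ≤ (v : ℕ) + 1 → (v : ℕ) ≤ (b q : ℕ) → p = q := by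
    intro v p q h1 h2 h3 h4
    by_contra hpq
    rcases h.separated p q hpq with h5 | h5 <;> omega
  have hex : ∀ v : Fin (n + 1), ∃ t : Fin l ⊕ FreeVertex r,
      (∀ p, t = Sum.inl p ↔ (a p : ℕ) ≤ (v : ℕ) + 1 ∧ (v : ℕ) ≤ (b p : ℕ)) ∧
      ∀ f, t = Sum.inr f ↔ v = f.1 := by
    intro v
    by_cases hv : r v.castSucc = 1 ∧ r v.succ = 1
    · refine ⟨Sum.inr ⟨v, hv⟩, fun p => ?_, fun f => ?_⟩
      · simp only [reduceCtorEq, false_iff]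
        exact fun hp => hfree v p hp.1 hp.2 hv
      · rw [Sum.inr.injEq, Subtype.ext_iff]
    · obtain ⟨q, hq, hq'⟩ := hblock v hv
      refine ⟨Sum.inl q, fun p => ?_, fun f => ?_⟩
      · rw [Sum.inl.injEq]
        constructor
        · rintro rfl
          exact ⟨hq, hq'⟩
        · exact fun hp => huniq v q p hq hq' hp.1 hp.2
      · simp only [reduceCtorEq, false_iff]
        rintro rfl
        exact hv f.2
  choose part hpart using hex
  exact ⟨part, fun v => (hpart v).1, fun v => (hpart v).2⟩

/-- A saturated block contains a vertex to which all bonds of the block are saturated: the point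
where its initial part ends, moved into the block if one of the two parts is empty. -/
theorem IsBlockDecomposition.exists_pivot (h : IsBlockDecomposition r a b)
    (hr_first : r 0 = 1) (hr_last : r (Fin.last (n + 1)) = 1) {k : Fin (n + 1) → ℕ} {p : Fin l}
    (hsat : RankSaturated k r (a p) (b p)) :
    ∃ c : Fin (n + 1), (a p : ℕ) ≤ (c : ℕ) + 1 ∧ (c : ℕ) ≤ (b p : ℕ) ∧
      ∀ v : Fin (n + 1), (a p : ℕ) ≤ (v : ℕ) + 1 → (v : ℕ) ≤ (b p : ℕ) →
        (v < c → r v.castSucc * k v ≤ r v.succ) ∧ (c < v → r v.succ * k v ≤ r v.castSucc) := by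
  obtain ⟨c₀, hc₀⟩ := hsat
  have hle := Fin.le_def.mp (h.le p)
  have ha : (a p : ℕ) ≠ 0 := by
    intro h0
    have h1 := (h.one_lt_iff (a p)).mpr ⟨p, le_rfl, h.le p⟩
    rw [show a p = 0 from Fin.ext h0, hr_first] at h1
    omega
  have hb : (b p : ℕ) ≠ n + 1 := by
    intro h0
    have h1 := (h.one_lt_iff (b p)).mpr ⟨p, h.le p, le_rfl⟩
    rw [show b p = Fin.last (n + 1) from Fin.ext h0, hr_last] at h1
    omega
  have hbn := (b p).isLt
  refine ⟨⟨min (max c₀ (a p - 1)) (b p), by omega⟩, ?_, ?_, fun v hv hv' => ⟨fun hvc => ?_,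
    fun hvc => ?_⟩⟩
  · simp only
    omega
  · simp only
    omega
  · have hvc : (v : ℕ) < min (max c₀ (a p - 1)) (b p) := hvc
    exact (hc₀ v).1 hv (by omega) (by omega)
  · have hvc : min (max c₀ (a p - 1)) (b p) < (v : ℕ) := hvc
    exact (hc₀ v).2 (by omega) hv' (by omega)

end Blocks

theorem factorSize_pos {n l : ℕ} {k : Fin (n + 1) → ℕ} (hk : ∀ v, 0 < k v) (r : Fin (n + 2) → ℕ)
    (a b : Fin l → Fin (n + 2)) (i : Fin l ⊕ FreeVertex r) : 0 < factorSize k r a b i := by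
  rcases i with p | v
  · exact (Finset.prod_pos fun v _ => hk v : 0 < blockSize k (a p) (b p))
  · exact hk v.1

theorem exists_ttVariety_eq_segreVariety {n l : ℕ} (k : Fin (n + 1) → ℕ) (r : Fin (n + 2) → ℕ)
    (hr : ∀ i, 0 < r i) (hr_first : r 0 = 1) (hr_last : r (Fin.last (n + 1)) = 1)
    (a b : Fin l → Fin (n + 2)) (hblocks : IsBlockDecomposition r a b)
    (hsat : ∀ p, RankSaturated k r (a p) (b p)) :
    ∃ ι : TIndex k ≃ ∀ i, Fin (factorSize k r a b i), ttVariety k r = segreVariety ι := by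
  obtain ⟨part, hinl, hinr⟩ := hblocks.exists_partition hr
  choose c hca hcb hc using fun p => hblocks.exists_pivot hr_first hr_last (hsat p)
  obtain ⟨ι, hι⟩ := exists_equiv_of_partition k part (factorSize k r a b) (by
    rintro (p | f)
    · simp only [hinl]
      rfl
    · simp only [hinr, Finset.filter_eq', Finset.mem_univ, if_true, Finset.prod_singleton]
      rfl)
  -- The pivot of a part with a single free vertex is this vertex.
  let pivot : Fin l ⊕ FreeVertex r → Fin (n + 1) := Sum.elim c fun f => f.1
  refine ⟨ι, ttVariety_eq_segreVariety (part := part) (c := pivot) hr hr_first hr_last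
    ?_ ?_ ?_ ?_ ?_ ?_ ι hι⟩
  · intro w v hwv h1
    have hwv : (w : ℕ) + 1 = v := congrArg Fin.val hwv
    have := hr w.succ
    obtain ⟨p, hp, hp'⟩ := (hblocks.one_lt_iff w.succ).mp (by omega)
    simp only [Fin.le_def, Fin.val_succ] at hp hp'
    rw [(hinl w p).mpr ⟨by omega, by omega⟩, (hinl v p).mpr ⟨by omega, by omega⟩]
  · rintro (p | f)
    · exact (hinl _ p).mpr ⟨hca p, hcb p⟩
    · exact (hinr _ f).mpr rfl
  · intro v w hvw hwc
    rcases hv : part v with p | f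
    · rw [hv] at hwc
      have h1 := (hinl v p).mp hv
      have hwc : w ≤ c p := hwc
      have h2 := hcb p
      simp only [Fin.le_def] at hvw hwc
      exact (hinl w p).mpr ⟨by omega, by omega⟩
    · rw [hv] at hwc
      exact (hinr w f).mpr (le_antisymm hwc (((hinr v f).mp hv).ge.trans hvw))
  · intro v w hcw hwv
    rcases hv : part v with p | f
    · rw [hv] at hcw
      have h1 := (hinl v p).mp hv
      have hcw : c p ≤ w := hcw
      have h2 := hca p
      simp only [Fin.le_def] at hwv hcw
      exact (hinl w p).mpr ⟨by omega, by omega⟩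
    · rw [hv] at hcw
      exact (hinr w f).mpr (le_antisymm (hwv.trans ((hinr v f).mp hv).le) hcw)
  · intro v hvc
    rcases hv : part v with p | f
    · rw [hv] at hvc
      have h1 := (hinl v p).mp hv
      exact (hc p v h1.1 h1.2).1 hvc
    · rw [hv, (hinr v f).mp hv] at hvc
      exact absurd hvc (lt_irrefl _)
  · intro v hvc
    rcases hv : part v with p | f
    · rw [hv] at hvc
      have h1 := (hinl v p).mp hv
      exact (hc p v h1.1 h1.2).2 hvc
    · rw [hv, (hinr v f).mp hv] at hvc
      exact absurd hvc (lt_irrefl _)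

theorem theorem2p5 {n l : ℕ} (k : Fin (n + 1) → ℕ) (r : Fin (n + 2) → ℕ)
    (hk : ∀ v, 0 < k v) (hr : ∀ i, 0 < r i)
    (hr_first : r 0 = 1) (hr_last : r (Fin.last (n + 1)) = 1)
    (a b : Fin l → Fin (n + 2)) (hblocks : IsBlockDecomposition r a b)
    (hsat : ∀ p, RankSaturated k r (a p) (b p)) :
    (∃ (e : ttVariety k r ≃ ∀ i, PSpace (Fin (factorSize k r a b i)))
        (ι : TIndex k ≃ ∀ i, Fin (factorSize k r a b i)),
      IsBiregular e ∧ IsSegreMap ι (fun y => (e.symm y : PSpace (TIndex k)))) ∧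
    topologicalKrullDim (ttVariety k r) =
      ((∑ p, (blockSize k (a p) (b p) - 1) + ∑ v : FreeVertex r, (k v.1 - 1) : ℕ) :
        WithBot ℕ∞) ∧
    HasDegree (ttVariety k r)
      (((∑ p, (blockSize k (a p) (b p) - 1) + ∑ v : FreeVertex r, (k v.1 - 1))! : ℕ) /
        ((∏ p, (blockSize k (a p) (b p) - 1)! : ℕ) *
          (∏ v : FreeVertex r, (k v.1 - 1)! : ℕ) : ℚ)) := by
  obtain ⟨ι, hι⟩ := exists_ttVariety_eq_segreVariety k r hr hr_first hr_last a b hblocks hsat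
  have hN := factorSize_pos hk r a b
  have hsum : ∑ i, (factorSize k r a b i - 1) =
      ∑ p, (blockSize k (a p) (b p) - 1) + ∑ v : FreeVertex r, (k v.1 - 1) :=
    Fintype.sum_sum_type _
  have hprod : ∏ i, (factorSize k r a b i - 1)! =
      (∏ p, (blockSize k (a p) (b p) - 1)!) * ∏ v : FreeVertex r, (k v.1 - 1)! :=
    Fintype.prod_sum_type _
  rw [hι, ← hsum, ← Nat.cast_mul, ← hprod]
  exact ⟨⟨segreEquiv ι, ι, isBiregular_segreEquiv ι, isSegreMap_segreEquiv_symm ι⟩,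
    topologicalKrullDim_segreVariety ι hN, hasDegree_segreVariety ι hN⟩
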